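/- **Setting.** Let $G=(V,E)$ be a finite simple graph with $n$ vertices, $m$ edges and maximum degree $\Delta$; $\mathrm d(v)$ is the degree of $v$, $w(e)=\min\{\mathrm d(u),\mathrm d(v)\}$ for an edge $e=(u,v)$, and $w(G)=\sum_{e\in E}w(e)$. The arboricity $\alpha$ of $G$ is the least integer $a$ such that every nonempty $S\subseteq V$ spans at most $a(|S|-1)$ edges. Let $\chi$ be a proper partial $(\Delta+1)$-edge-coloring of $G$ that leaves exactly $l\ge 1$ edges uncolored, and let $M(v)$ be the set of the colors in $\{1,\dots,\Delta+1\}$ that occur on no edge at $v$ (missing colors). **Algorithm Color-One-Edge$(G,\chi)$.** 1. Choose a uniformly random uncolored edge $e=(u,v)$, named so that $\mathrm d(u)\le \mathrm d(v)$ (ties broken arbitrarily). 2. (Make-Primed-Fan) Start with the fan with center $u$ and the single leaf $x_0=v$. Repeat: with leaves $x_0,\dots,x_t$, pick any $c_1\in M(x_t)$; if $c_1\in M(u)$, stop; otherwise let $(u,y)$ be the edge at $u$ of color $c_1$; if $y$ is already a leaf, stop; otherwise append $x_{t+1}=y$. 3. Choose a uniformly random color $c_0\in M(u)$: if $\mathrm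 d(u)>\Delta/2$, list all of $M(u)$ by testing every color, and sample from the list; otherwise sample from the whole palette until a color of $M(u)$ is obtained. 4. Compute edge by edge the maximal path $P$ that starts at $u$ and whose edges have the colors $c_1,c_0,c_1,\dots$ alternately ($P$ is empty if $c_1\in M(u)$). 5. (Extend-Coloring) To shift the fan from $x_j$ means to give $(u,x_{i-1})$ the color of $(u,x_i)$ for $i=1,\dots,j$ and to uncolor $(u,x_j)$. If $c_1\in M(u)$, shift the fan from $x_t$ and color $(u,x_t)$ by $c_1$. Otherwise let $x_j$ be the leaf such that $(u,x_j)$ has color $c_1$, and let $w$ be the last vertex of $P$; exchange the two colors along $P$; if $w\ne x_{j-1}$, shift the fan from $x_{j-1}$ and color $(u,x_{j-1})$ by $c_1$; if $w=x_{j-1}$, shift the fan from $x_t$ and color $(u,x_t)$ by $c_1$. **Running time.** Elementary operations (arithmetic on words, array and pointer accesses, sampling of a random index, obtaining some missing color of a vertex or a random uncolored edge, updating the list of missing colors of a vertex and the array of uncolored edges) take constant time. Every non-isolated vertex $v$ has a hash table with chaining and $\mathrm d(v)$ buckets, which stores for each color occurring at $v$ the edge at $v$ with that color; the leaves of the fan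 are stored in such a table with $\mathrm d(u)$ buckets, allocated in time $O(\mathrm d(u))$. An access to a table costs one unit plus the number of the stored keys in the bucket that is accessed. Vertices and colors are numbered from $0$; key number $x$ is hashed into bucket $((ax+b)\bmod p)\bmod s$ of a table with $s$ buckets, where $p>n$ is a prime and $a,b$ are uniformly random in $\{0,\dots,p-1\}$, independent of the random choices of the algorithm. **Lemma (Color-One-Edge Bound).** The expected running time of Color-One-Edge on $G$ and $\chi$ (over the random choices of the algorithm and of $a,b$) is $$O\!\left(\frac{w(G)}{l}\right)=O\!\left(\frac{m\alpha}{l}\right).$$ More explicitly, there is an absolute constant $C$ such that, for all $G$, $\chi$, $l\ge1$ and $p$ as above and all ways to make the arbitrary choices in steps 1 and 2, the expected running time is at most $C\,\frac{w(G)}{l}$ and at most $C\,\frac{m\alpha}{l}$, and $\frac{w(G)}{l}\le C\,\frac{m\alpha}{l}$. -/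

import Mathlib

open scoped ENNReal

namespace EdgeColoring

/-! ### Graphs, weights, arboricity, partial colorings -/

/-- The weight of an edge: the minimum degree of its endpoints. -/
def edgeWeight {n : ℕ} (G : SimpleGraph (Fin n)) [DecidableRel G.Adj] (e : Sym2 (Fin n)) : ℕ :=
  Sym2.lift ⟨fun u v => min (G.degree u) (G.degree v), fun _ _ => min_comm _ _⟩ e

/-- The weight `w(G)` of a graph: the sum of the weights of its edges. -/
def graphWeight {n : ℕ} (G : SimpleGraph (Fin n)) [DecidableRel G.Adj] : ℕ :=
  ∑ e ∈ G.edgeFinset, edgeWeight G e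

/-- The arboricity: the least integer `a` with `m_S ≤ a (n_S - 1)` for every nonempty vertex set
`S`, where `n_S = |S|` and `m_S` is the number of edges of `G` with both endpoints in `S`. -/
noncomputable def arboricity {n : ℕ} (G : SimpleGraph (Fin n)) [DecidableRel G.Adj] : ℕ :=
  sInf {a : ℕ | ∀ S : Finset (Fin n), S.Nonempty →
    (G.edgeFinset ∩ S.sym2).card ≤ a * (S.card - 1)}

/-- A color assignment with palette `Fin k`; `none` means "uncolored". -/
abbrev Coloring (n k : ℕ) := Sym2 (Fin n) → Option (Fin k)

/-- `χ` is a proper partial `k`-coloring of the edges of `G` (pairs that are not edges of `G`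
carry no color). -/
structure IsPartialColoring {n k : ℕ} (G : SimpleGraph (Fin n)) (χ : Coloring n k) : Prop where
  edge : ∀ e, χ e ≠ none → e ∈ G.edgeSet
  proper : ∀ e e' : Sym2 (Fin n), e ≠ e' → (∃ v, v ∈ e ∧ v ∈ e') →
    ∀ c, χ e = some c → χ e' ≠ some c

/-- The set of edges of `G` left uncolored by `χ`. -/
def uncolored {n k : ℕ} (G : SimpleGraph (Fin n)) [DecidableRel G.Adj] (χ : Coloring n k) :
    Finset (Sym2 (Fin n)) :=
  G.edgeFinset.filter fun e => χ e = none

/-- The set `M(v)` of colors missing at `v`. -/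
def missing {n k : ℕ} (G : SimpleGraph (Fin n)) [DecidableRel G.Adj] (χ : Coloring n k)
    (v : Fin n) : Finset (Fin k) :=
  Finset.univ.filter fun c => ∀ x, G.Adj v x → χ s(v, x) ≠ some c

/-- The other endpoint of the edge at `v` that has color `c`, if there is one. -/
def lookup {n k : ℕ} (G : SimpleGraph (Fin n)) [DecidableRel G.Adj] (χ : Coloring n k)
    (v : Fin n) (c : Fin k) : Option (Fin n) :=
  (List.finRange n).find? fun x => decide (G.Adj v x ∧ χ s(v, x) = some c)

/-! ### The algorithm Color-One-Edge as a randomized step machine -/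

/-- A rule for the choices that the algorithm leaves open: which endpoint `low e` of an edge `e`
counts as the endpoint of minimum degree (this matters for ties only), and which missing color
of the last leaf `x` is picked when the fan is centered at `u` and has the leaves `F` before `x`. -/
structure Choices {n k : ℕ} (G : SimpleGraph (Fin n)) [DecidableRel G.Adj]
    (χ : Coloring n k) where
  low : Sym2 (Fin n) → Fin n
  high : Sym2 (Fin n) → Fin n
  ends_eq : ∀ e, s(low e, high e) = e
  degree_le : ∀ e, G.degree (low e) ≤ G.degree (high e)
  pick : Fin n → List (Fin n) → Fin n → Fin k
  pick_mem : ∀ u F x, pick u F x ∈ missing G χ x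

/-- The control points of the algorithm, with the values of its local variables. -/
inductive Control (n k : ℕ) where
  /-- choose a random uncolored edge -/
  | pickEdge
  /-- allocate the (hash) table of leaves of a fan with center `u` and first leaf `v` -/
  | initFan (u v : Fin n)
  /-- an iteration of Make-Primed-Fan on the fan with center `u` and leaves `F ++ [x]` -/
  | growFan (u : Fin n) (F : List (Fin n)) (x : Fin n)
  /-- the fan with center `u` and leaves `F` is primed by `c₁`: begin the choice of `c₀ ∈ M(u)` -/
  | chooseColor (u : Fin n) (F : List (Fin n)) (c₁ : Fin k)
  /-- collect in the array `A` the missing colors of `u`; color number `i` is examined next -/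
  | scan (u : Fin n) (F : List (Fin n)) (c₁ : Fin k) (i : ℕ) (A : List (Fin k))
  /-- sample a random color of the whole palette -/
  | sample (u : Fin n) (F : List (Fin n)) (c₁ : Fin k)
  /-- test whether the sampled color `c` is missing at `u` -/
  | test (u : Fin n) (F : List (Fin n)) (c₁ c : Fin k)
  /-- compute the maximal `(c₀, c₁)`-alternating path starting at `u`: the edges found so far are
  `P`, the path has reached `x`, the color sought next is `a`, and the other color is `b` -/
  | walk (u : Fin n) (F : List (Fin n)) (c₀ c₁ : Fin k) (x : Fin n) (a b : Fin k)
      (P : List (Fin n × Fin n))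
  /-- Extend-Coloring with the path `P`, whose other endpoint is `w` -/
  | extend (u : Fin n) (F : List (Fin n)) (c₀ c₁ : Fin k) (P : List (Fin n × Fin n)) (w : Fin n)
  /-- first pass of the flip of `P`: the edges in `Q` are still to be uncolored; afterwards the
  fan with leaves `R` is to be shifted from its last leaf -/
  | erase (u : Fin n) (R : List (Fin n)) (c₀ c₁ : Fin k) (P Q : List (Fin n × Fin n))
  /-- second pass of the flip of `P`: the edges in `Q` are still to be colored, alternately with
  `a` and `b` -/
  | paint (u : Fin n) (R : List (Fin n)) (c₁ a b : Fin k) (Q : List (Fin n × Fin n))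
  /-- shift the fan with center `u` and leaves `R` from its last leaf (the edge of `u` and the
  first leaf is uncolored), and then color the edge of `u` and the last leaf by `c₁` -/
  | shift (u : Fin n) (R : List (Fin n)) (c₁ : Fin k)
  /-- the algorithm has returned -/
  | done

/-- A configuration: the current coloring and the control point. -/
structure Config (n k : ℕ) where
  col : Coloring n k
  ctl : Control n k

/-- The possible successors of a configuration; one of them is chosen uniformly at random. -/
def next {n k : ℕ} (G : SimpleGraph (Fin n)) [DecidableRel G.Adj] {χ₀ : Coloring n k}
    (ch : Choices G χ₀) : Config n k → Multiset (Config n k)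
  | ⟨χ, .pickEdge⟩ => (uncolored G χ).val.map fun e => ⟨χ, .initFan (ch.low e) (ch.high e)⟩
  | ⟨χ, .initFan u v⟩ => {⟨χ, .growFan u [] v⟩}
  | ⟨χ, .growFan u F x⟩ =>
      match lookup G χ u (ch.pick u F x) with
      | none => {⟨χ, .chooseColor u (F ++ [x]) (ch.pick u F x)⟩}
      | some y =>
          if y ∈ F ++ [x] then {⟨χ, .chooseColor u (F ++ [x]) (ch.pick u F x)⟩}
          else {⟨χ, .growFan u (F ++ [x]) y⟩}
  | ⟨χ, .chooseColor u F c₁⟩ =>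
      if G.maxDegree < 2 * G.degree u then {⟨χ, .scan u F c₁ 0 []⟩} else {⟨χ, .sample u F c₁⟩}
  | ⟨χ, .scan u F c₁ i A⟩ =>
      if hi : i < k then
        match lookup G χ u ⟨i, hi⟩ with
        | none => {⟨χ, .scan u F c₁ (i + 1) (A ++ [⟨i, hi⟩])⟩}
        | some _ => {⟨χ, .scan u F c₁ (i + 1) A⟩}
      else (A : Multiset (Fin k)).map fun c => ⟨χ, .walk u F c c₁ u c₁ c []⟩
  | ⟨χ, .sample u F c₁⟩ => (Finset.univ : Finset (Fin k)).val.map fun c => ⟨χ, .test u F c₁ c⟩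
  | ⟨χ, .test u F c₁ c⟩ =>
      match lookup G χ u c with
      | none => {⟨χ, .walk u F c c₁ u c₁ c []⟩}
      | some _ => {⟨χ, .sample u F c₁⟩}
  | ⟨χ, .walk u F c₀ c₁ x a b P⟩ =>
      match lookup G χ x a with
      | none => {⟨χ, .extend u F c₀ c₁ P x⟩}
      | some y => {⟨χ, .walk u F c₀ c₁ y b a (P ++ [(x, y)])⟩}
  | ⟨χ, .extend u F c₀ c₁ P w⟩ =>
      match lookup G χ u c₁ with
      | none => {⟨χ, .shift u F c₁⟩}
      | some y =>
          -- `y` is the leaf `x_j`, and the list below is `x_0, ..., x_{j-1}`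
          if (F.takeWhile fun x => decide (x ≠ y)).getLast? ≠ some w then
            {⟨χ, .erase u (F.takeWhile fun x => decide (x ≠ y)) c₀ c₁ P P⟩}
          else {⟨χ, .erase u F c₀ c₁ P P⟩}
  | ⟨χ, .erase u R c₀ c₁ P []⟩ => {⟨χ, .paint u R c₁ c₀ c₁ P⟩}
  | ⟨χ, .erase u R c₀ c₁ P ((x, y) :: Q)⟩ =>
      {⟨Function.update χ s(x, y) none, .erase u R c₀ c₁ P Q⟩}
  | ⟨χ, .paint u R c₁ _ _ []⟩ => {⟨χ, .shift u R c₁⟩}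
  | ⟨χ, .paint u R c₁ a b ((x, y) :: Q)⟩ =>
      {⟨Function.update χ s(x, y) (some a), .paint u R c₁ b a Q⟩}
  | ⟨χ, .shift _ [] _⟩ => {⟨χ, .done⟩}
  | ⟨χ, .shift u [x] c₁⟩ => {⟨Function.update χ s(u, x) (some c₁), .done⟩}
  | ⟨χ, .shift u (x :: y :: R) c₁⟩ =>
      {⟨Function.update (Function.update χ s(u, y) none) s(u, x) (χ s(u, y)),
        .shift u (y :: R) c₁⟩}
  | ⟨χ, .done⟩ => {⟨χ, .done⟩}

/-- One step of the machine: a uniformly random successor. -/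
noncomputable def step {n k : ℕ} (G : SimpleGraph (Fin n)) [DecidableRel G.Adj]
    {χ₀ : Coloring n k} (ch : Choices G χ₀) (s : Config n k) : PMF (Config n k) :=
  open Classical in
  if hs : next G ch s ≠ 0 then PMF.ofMultiset (next G ch s) hs else PMF.pure s

/-- The law of the configuration after `t` steps, for the input `χ`. -/
noncomputable def lawAt {n k : ℕ} (G : SimpleGraph (Fin n)) [DecidableRel G.Adj]
    {χ : Coloring n k} (ch : Choices G χ) : ℕ → PMF (Config n k)
  | 0 => PMF.pure ⟨χ, .pickEdge⟩
  | t + 1 => (lawAt G ch t).bind (step G ch)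

/-! ### The running time

Every step costs one unit for its constant number of word operations (arithmetic, comparison,
array and pointer access, sampling of a random index, updates of the list of missing colors and of
the array of uncolored edges), and in addition every access to a hash table with chaining costs
the number of keys that are inspected. -/

/-- The hash function `x ↦ ((a x + b) mod p) mod s` for a table with `s` buckets. -/
def hash (p a b s x : ℕ) : ℕ := (a * x + b) % p % s

/-- Cost of an access with key `c` to the hash table of the vertex `v`. The table has `d(v)`
buckets, and its keys are the colors that occur at `v`. -/
def probe {n k : ℕ} (h : ℕ → ℕ → ℕ) (G : SimpleGraph (Fin n)) [DecidableRel G.Adj]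
    (χ : Coloring n k) (v : Fin n) (c : Fin k) : ℕ :=
  1 + ((missing G χ v)ᶜ.filter fun c' : Fin k => h (G.degree v) c'.val = h (G.degree v) c.val).card

/-- Cost of an access with key `y` to the hash table of the leaves `F` of a fan with center `u`.
The table has `d(u)` buckets. -/
def leafProbe {n : ℕ} (h : ℕ → ℕ → ℕ) (G : SimpleGraph (Fin n)) [DecidableRel G.Adj]
    (u : Fin n) (F : List (Fin n)) (y : Fin n) : ℕ :=
  1 + F.countP fun x => decide (h (G.degree u) x.val = h (G.degree u) y.val)

/-- Cost of setting or deleting the color `c` of the edge `s(x, y)` in the tables of `x`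
and `y`. -/
def recolorCost {n k : ℕ} (h : ℕ → ℕ → ℕ) (G : SimpleGraph (Fin n)) [DecidableRel G.Adj]
    (χ : Coloring n k) (x y : Fin n) : Option (Fin k) → ℕ
  | none => 0
  | some c => probe h G χ x c + probe h G χ y c

/-- The cost of the step that leaves a configuration; it is positive until the algorithm has
returned. -/
def cost {n k : ℕ} (h : ℕ → ℕ → ℕ) (G : SimpleGraph (Fin n)) [DecidableRel G.Adj]
    {χ₀ : Coloring n k} (ch : Choices G χ₀) : Config n k → ℕ
  | ⟨_, .pickEdge⟩ => 1
  | ⟨_, .initFan u v⟩ => 1 + G.degree u + leafProbe h G u [] v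
  | ⟨χ, .growFan u F x⟩ =>
      1 + probe h G χ u (ch.pick u F x) +
        match lookup G χ u (ch.pick u F x) with
        | none => 0
        -- membership test and insertion
        | some y => leafProbe h G u (F ++ [x]) y + leafProbe h G u (F ++ [x]) y
  | ⟨_, .chooseColor _ _ _⟩ => 1
  | ⟨χ, .scan u _ _ i _⟩ => 1 + if hi : i < k then probe h G χ u ⟨i, hi⟩ else 0
  | ⟨_, .sample _ _ _⟩ => 1
  | ⟨χ, .test u _ _ c⟩ => 1 + probe h G χ u c
  | ⟨χ, .walk _ _ _ _ x a _ _⟩ => 1 + probe h G χ x a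
  -- lookup of `c₁` at `u` and a search through the list of leaves
  | ⟨χ, .extend u F _ c₁ _ _⟩ => 1 + probe h G χ u c₁ + F.length
  | ⟨_, .erase _ _ _ _ _ []⟩ => 1
  | ⟨χ, .erase _ _ _ _ _ ((x, y) :: _)⟩ => 1 + recolorCost h G χ x y (χ s(x, y))
  | ⟨_, .paint _ _ _ _ _ []⟩ => 1
  | ⟨χ, .paint _ _ _ a _ ((x, y) :: _)⟩ => 1 + recolorCost h G χ x y (some a)
  | ⟨_, .shift _ [] _⟩ => 1
  | ⟨χ, .shift u [x] c₁⟩ => 1 + recolorCost h G χ u x (some c₁)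
  | ⟨χ, .shift u (x :: y :: _) _⟩ =>
      1 + recolorCost h G χ u y (χ s(u, y)) +
        recolorCost h G (Function.update χ s(u, y) none) u x (χ s(u, y))
  | ⟨_, .done⟩ => 0

/-- The expected total cost of a run, for a fixed hash function. -/
noncomputable def expectedCost {n k : ℕ} (h : ℕ → ℕ → ℕ) (G : SimpleGraph (Fin n))
    [DecidableRel G.Adj] {χ : Coloring n k} (ch : Choices G χ) : ℝ≥0∞ :=
  ∑' t : ℕ, ∑' s : Config n k, lawAt G ch t s * (cost h G ch s : ℝ≥0∞)

/-- The expected running time of Color-One-Edge on `G` and `χ`: the expectation is over the random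
choices of the run and over the parameters `a, b` of the hash function, which are uniform in
`{0, ..., p - 1}` and independent of the run. -/
noncomputable def expectedTime {n k : ℕ} (p : ℕ) (G : SimpleGraph (Fin n))
    [DecidableRel G.Adj] {χ : Coloring n k} (ch : Choices G χ) : ℝ≥0∞ :=
  (∑ a : Fin p, ∑ b : Fin p, expectedCost (hash p a b) G ch) / (p : ℝ≥0∞) ^ 2

end EdgeColoring

open scoped ENNReal

namespace EdgeColoring

/-! ### Universal hashing -/

/-! Every table has at most as many keys as buckets, so under the random hash function an access has
mean cost at most 4, whatever the current coloring is. The run does not look at the hash parameters,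
so these means may replace the actual costs.

Let `u` be the endpoint of smaller degree of the chosen edge. Building and shifting the fan costs
O(d(u)). So does choosing `c₀`: either the palette has at most 2d(u) colors, or at least half of it
is missing at `u` and two trials suffice on average. Since d(u) is the weight of the edge, averaging
over the uncolored edges gives O(w(G)/l).

It remains to bound the alternating path. By properness (`altStep_injective`), walks from different
starts, each with its second color missing at its start, never share a state. An interior edge xy,
traversed from x to y, has its neighboring path edges of one color `b`, which occurs at both x and
y; so at most min(d(x), d(y)) paths use it in this direction, and all interior lengths add up to at
most 2w(G) (`sum_altInner_le`). A pair (u, c₀) is chosen with probability at most 1/l: at most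
|M(u)| uncolored edges lead to `u`, and `c₀` is uniform in M(u) (`sum_meanInner_low_le`). Thus the
mean interior length is at most 2w(G)/l.

A potential whose mean drop pays for each step (`drift`, `tsum_cost_le_potential`) combines these
estimates. The arboricity bound is the separate inequality `graphWeight_le`. -/

lemma hash_pair_injective {p x y : ℕ} (hp : p.Prime) (hx : x < p) (hy : y < p) (hxy : x ≠ y) :
    Function.Injective fun q : Fin p × Fin p =>
      ((q.1.val * x + q.2.val) % p, (q.1.val * y + q.2.val) % p) := by
  have : Fact p.Prime := ⟨hp⟩
  rintro ⟨a, b⟩ ⟨a', b'⟩ h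
  simp only [Prod.mk.injEq] at h
  have h1 := (ZMod.natCast_eq_natCast_iff _ _ p).2 h.1
  have h2 := (ZMod.natCast_eq_natCast_iff _ _ p).2 h.2
  push_cast at h1 h2
  have hne : (x : ZMod p) - y ≠ 0 := by
    intro h0
    apply hxy
    have := (ZMod.natCast_eq_natCast_iff x y p).1 (sub_eq_zero.1 h0)
    rwa [Nat.ModEq, Nat.mod_eq_of_lt hx, Nat.mod_eq_of_lt hy] at this
  have h3 : ((a.val : ZMod p) - a'.val) * ((x : ZMod p) - y) = 0 := by
    linear_combination h1 - h2
  have h4 : (a.val : ZMod p) = a'.val :=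
    sub_eq_zero.1 ((mul_eq_zero.1 h3).resolve_right hne)
  have h5 : (b.val : ZMod p) = b'.val := by
    rw [h4] at h1
    exact add_left_cancel h1
  have lift : ∀ i j : Fin p, (i.val : ZMod p) = j.val → i = j := by
    intro i j hij
    have := (ZMod.natCast_eq_natCast_iff i.val j.val p).1 hij
    rw [Nat.ModEq, Nat.mod_eq_of_lt i.2, Nat.mod_eq_of_lt j.2] at this
    exact Fin.ext this
  exact Prod.ext (lift _ _ h4) (lift _ _ h5)

/-- By injectivity, collisions are counted by pairs of residues below `p` that agree modulo `s`: `p`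
choices for the first and at most p/s + 1 for the second. -/
lemma card_hash_collision_mul_le {p x y s : ℕ} (hp : p.Prime) (hx : x < p) (hy : y < p)
    (hxy : x ≠ y) (hs : 0 < s) (hsp : s ≤ p) :
    ((Finset.univ : Finset (Fin p × Fin p)).filter fun q =>
      hash p q.1 q.2 s x = hash p q.1 q.2 s y).card * s ≤ 2 * p ^ 2 := by
  have h1 : ((Finset.univ : Finset (Fin p × Fin p)).filter fun q =>
      hash p q.1 q.2 s x = hash p q.1 q.2 s y).card ≤
      ((Finset.range p).sigma fun r => (Finset.range p).filter fun t => t ≡ r [MOD s]).card := by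
    apply Finset.card_le_card_of_injOn
      (fun q => ⟨(q.1.val * x + q.2.val) % p, (q.1.val * y + q.2.val) % p⟩)
    · intro q hq
      have hq' := (Finset.mem_filter.1 (Finset.mem_coe.1 hq)).2
      exact Finset.mem_coe.2 (Finset.mem_sigma.2 ⟨Finset.mem_range.2 (Nat.mod_lt _ hp.pos),
        Finset.mem_filter.2 ⟨Finset.mem_range.2 (Nat.mod_lt _ hp.pos), hq'.symm⟩⟩)
    · intro q _ q' _ h
      simp only [Sigma.mk.injEq, heq_eq_eq] at h
      exact hash_pair_injective hp hx hy hxy (Prod.ext h.1 h.2)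
  have h2 : ∀ r, ((Finset.range p).filter fun t => t ≡ r [MOD s]).card ≤ p / s + 1 := by
    intro r
    rw [← Nat.count_eq_card_filter_range, Nat.count_modEq_card p hs]
    split_ifs <;> omega
  rw [Finset.card_sigma] at h1
  have h3 : ∑ r ∈ Finset.range p, ((Finset.range p).filter fun t => t ≡ r [MOD s]).card
      ≤ p * (p / s + 1) := by
    refine (Finset.sum_le_sum fun r _ => h2 r).trans ?_
    simp
  calc _ ≤ p * (p / s + 1) * s := Nat.mul_le_mul_right _ (h1.trans h3)
    _ = p * (p / s * s + s) := by ring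
    _ ≤ p * (p + p) := Nat.mul_le_mul_left _ (add_le_add (Nat.div_mul_le_self p s) hsp)
    _ = 2 * p ^ 2 := by ring

/-- Under a random hash function with at least as many buckets as keys, the expected size of a
bucket is at most three. -/
lemma sum_bucket_le {p s y : ℕ} (hp : p.Prime) (T : Finset ℕ) (hT : ∀ x ∈ T, x < p)
    (hy : y < p) (hTs : T.card ≤ s) (hsp : s ≤ p) :
    ∑ a : Fin p, ∑ b : Fin p, (T.filter fun x => hash p a b s x = hash p a b s y).card
      ≤ 3 * p ^ 2 := by
  rcases Nat.eq_zero_or_pos s with rfl | hs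
  · simp [Finset.card_eq_zero.1 (Nat.le_zero.1 hTs)]
  have hswap : ∑ a : Fin p, ∑ b : Fin p,
      (T.filter fun x => hash p a b s x = hash p a b s y).card =
      ∑ x ∈ T, ((Finset.univ : Finset (Fin p × Fin p)).filter fun q =>
        hash p q.1 q.2 s x = hash p q.1 q.2 s y).card := by
    simp_rw [Finset.card_filter]
    rw [← Fintype.sum_prod_type' (f := fun a b : Fin p =>
      ∑ x ∈ T, if hash p a b s x = hash p a b s y then 1 else 0), Finset.sum_comm]
  rw [hswap]
  refine Nat.le_of_mul_le_mul_right ?_ hs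
  have hall : ∀ x, ((Finset.univ : Finset (Fin p × Fin p)).filter fun q =>
        hash p q.1 q.2 s x = hash p q.1 q.2 s y).card ≤ p ^ 2 := by
    intro x
    refine (Finset.card_filter_le _ _).trans ?_
    simp [sq]
  -- The key `y` may itself lie in `T` and then always collides; this is the third p², next to the
  -- two from the other keys.
  calc _ ≤ ∑ x ∈ T, ((if x = y then p ^ 2 * s else 0) + 2 * p ^ 2) := by
        rw [Finset.sum_mul]
        refine Finset.sum_le_sum fun x hx => ?_
        split_ifs with h
        · exact (Nat.mul_le_mul_right _ (hall x)).trans (Nat.le_add_right _ _)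
        · rw [zero_add]
          exact card_hash_collision_mul_le hp (hT x hx) hy h hs hsp
    _ ≤ p ^ 2 * s + T.card * (2 * p ^ 2) := by
        rw [Finset.sum_add_distrib, Finset.sum_const, smul_eq_mul, Finset.sum_ite_eq']
        gcongr
        split_ifs <;> simp
    _ ≤ p ^ 2 * s + s * (2 * p ^ 2) := by gcongr
    _ = 3 * p ^ 2 * s := by ring

/-! ### Weight and arboricity -/

section Graph

variable {n : ℕ} (G : SimpleGraph (Fin n)) [DecidableRel G.Adj]

lemma arboricity_spec (S : Finset (Fin n)) (hS : S.Nonempty) :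
    (G.edgeFinset ∩ S.sym2).card ≤ arboricity G * (S.card - 1) := by
  refine Nat.sInf_mem (s := {a : ℕ | ∀ S : Finset (Fin n), S.Nonempty →
    (G.edgeFinset ∩ S.sym2).card ≤ a * (S.card - 1)}) ?_ S hS
  -- The infimum is attained once some bound exists. The number of edges is one: a singleton spans
  -- no edge, and otherwise the factor |S| - 1 is positive.
  refine ⟨G.edgeFinset.card, fun S hS => ?_⟩
  rcases Nat.lt_or_ge 1 S.card with h | h
  · exact (Finset.card_le_card Finset.inter_subset_left).trans
      (Nat.le_mul_of_pos_right _ (by omega))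
  · obtain ⟨v, rfl⟩ := Finset.card_eq_one.1 (le_antisymm h hS.card_pos)
    simp

lemma card_edges_inter_le (S : Finset (Fin n)) :
    (G.edgeFinset ∩ S.sym2).card ≤ arboricity G * S.card := by
  rcases S.eq_empty_or_nonempty with rfl | hS
  · simp
  · exact (arboricity_spec G S hS).trans (Nat.mul_le_mul_left _ (Nat.sub_le _ _))

lemma eq_sum_range_ite {d N : ℕ} (h : d ≤ N) :
    d = ∑ t ∈ Finset.range N, if t < d then 1 else 0 := by
  rw [← Finset.card_filter]
  have : (Finset.range N).filter (fun t => t < d) = Finset.range d := by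
    ext t
    simp only [Finset.mem_filter, Finset.mem_range]
    omega
  rw [this, Finset.card_range]

lemma edgeWeight_mk (u v : Fin n) : edgeWeight G s(u, v) = min (G.degree u) (G.degree v) := rfl

/-- Layer-cake summation: an edge has weight above `t` exactly when both ends lie in the set of
vertices of degree above `t`. Arboricity bounds the edges inside each such set, and the sizes of
these sets add up to the degree sum 2m. -/
lemma graphWeight_le : graphWeight G ≤ 2 * (G.edgeFinset.card * arboricity G) := by
  have hdeg : ∀ v, G.degree v ≤ n := fun v => (G.degree_lt_card_verts v).le.trans (by simp)
  have hw : ∀ e, edgeWeight G e ≤ n := by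
    intro e
    induction e with
    | _ a b => exact (min_le_left _ _).trans (hdeg a)
  calc graphWeight G
      = ∑ e ∈ G.edgeFinset, ∑ t ∈ Finset.range n, if t < edgeWeight G e then 1 else 0 :=
        Finset.sum_congr rfl fun e _ => eq_sum_range_ite (hw e)
    _ = ∑ t ∈ Finset.range n, (G.edgeFinset.filter fun e => t < edgeWeight G e).card := by
        rw [Finset.sum_comm]
        simp_rw [Finset.card_filter]
    _ ≤ ∑ t ∈ Finset.range n,
          arboricity G * ((Finset.univ : Finset (Fin n)).filter fun v => t < G.degree v).card := by
        refine Finset.sum_le_sum fun t _ => le_trans (Finset.card_le_card ?_)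
          (card_edges_inter_le G _)
        intro e
        induction e with
        | _ a b =>
          simp only [Finset.mem_filter, Finset.mem_inter, edgeWeight_mk, lt_min_iff,
            Finset.mk_mem_sym2_iff, Finset.mem_univ, true_and]
          exact id
    _ = arboricity G * ∑ v, G.degree v := by
        rw [← Finset.mul_sum]
        congr 1
        simp_rw [Finset.card_filter]
        rw [Finset.sum_comm]
        exact Finset.sum_congr rfl fun v _ => (eq_sum_range_ite (hdeg v)).symm
    _ = 2 * (G.edgeFinset.card * arboricity G) := by
        rw [G.sum_degrees_eq_twice_card_edges]
        ring

lemma sum_adj_min_degree :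
    ∑ x, ∑ y ∈ G.neighborFinset x, min (G.degree x) (G.degree y) = 2 * graphWeight G := by
  have h1 : ∑ d : G.Dart, edgeWeight G d.edge = 2 * graphWeight G := by
    rw [graphWeight, Finset.mul_sum,
      ← Finset.sum_fiberwise_of_maps_to (s := Finset.univ) (t := G.edgeFinset)
        (g := fun d : G.Dart => d.edge) (fun d _ => by simp)]
    refine Finset.sum_congr rfl fun e he => ?_
    rw [Finset.sum_congr rfl (g := fun _ => edgeWeight G e)
      (fun d hd => by rw [(Finset.mem_filter.1 hd).2]), Finset.sum_const,
      G.dart_edge_fiber_card e (by simpa using he), smul_eq_mul]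
  rw [← h1, Finset.sum_sigma']
  refine Finset.sum_bij'
    (i := fun q hq => (⟨(q.1, q.2), by simpa using hq⟩ : G.Dart))
    (j := fun d _ => ⟨d.fst, d.snd⟩) ?_ ?_ ?_ ?_ ?_
  · simp
  · intro d _
    simp
  · simp
  · simp
  · intro q hq
    rfl

/-! ### Colored edges and missing colors -/

variable {k : ℕ} {χ : Coloring n k}

lemma lookup_eq_some {v y : Fin n} {c : Fin k} (h : lookup G χ v c = some y) :
    G.Adj v y ∧ χ s(v, y) = some c := by
  simpa using List.find?_some h

lemma lookup_eq_none_iff {v : Fin n} {c : Fin k} :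
    lookup G χ v c = none ↔ c ∈ missing G χ v := by
  simp [lookup, missing]

lemma lookup_ne_none {v y : Fin n} {c : Fin k} (hv : G.Adj v y) (hc : χ s(v, y) = some c) :
    lookup G χ v c ≠ none := by
  rw [Ne, lookup_eq_none_iff]
  intro h
  exact (Finset.mem_filter.1 h).2 y hv hc

lemma lookup_eq_of_proper (hχ : IsPartialColoring G χ) {v y : Fin n} {c : Fin k}
    (hv : G.Adj v y) (hc : χ s(v, y) = some c) : lookup G χ v c = some y := by
  obtain ⟨z, hz⟩ := Option.ne_none_iff_exists'.1 (lookup_ne_none G hv hc)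
  have h := lookup_eq_some G hz
  rw [hz]
  by_contra hne
  refine hχ.proper s(v, z) s(v, y) ?_ ⟨v, by simp, by simp⟩ c h.2 hc
  intro he
  exact hne (congrArg some (Sym2.congr_right.1 he))

/-- Properness plays no role here, so the bound on table sizes remains valid while a path is being
recolored. -/
lemma card_compl_missing_le (χ : Coloring n k) (v : Fin n) :
    (missing G χ v)ᶜ.card ≤
      ((G.neighborFinset v).filter fun y => χ s(v, y) ≠ none).card := by
  classical
  rw [← Finset.card_map Function.Embedding.some]
  refine (Finset.card_le_card ?_).trans (Finset.card_image_le (f := fun y => χ s(v, y)))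
  intro o ho
  obtain ⟨c, hc, rfl⟩ := Finset.mem_map.1 ho
  obtain ⟨y, hy, hyc⟩ : ∃ y, G.Adj v y ∧ χ s(v, y) = some c := by
    simpa [missing] using hc
  refine Finset.mem_image.2 ⟨y, ?_, hyc⟩
  simp [hy, hyc]

lemma card_compl_missing_le_degree (χ : Coloring n k) (v : Fin n) :
    (missing G χ v)ᶜ.card ≤ G.degree v :=
  (card_compl_missing_le G χ v).trans (Finset.card_filter_le _ _)

lemma le_card_missing_add_degree (χ : Coloring n k) (v : Fin n) :
    k ≤ (missing G χ v).card + G.degree v := by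
  have h := card_compl_missing_le_degree G χ v
  rw [Finset.card_compl, Fintype.card_fin] at h
  omega

/-- At every vertex there are at least as many missing colors as uncolored edges. -/
lemma card_uncolored_at_le (hk : k = G.maxDegree + 1) (χ : Coloring n k) (v : Fin n) :
    ((G.neighborFinset v).filter fun y => χ s(v, y) = none).card ≤ (missing G χ v).card := by
  have h := card_compl_missing_le G χ v
  have h1 := Finset.card_filter_add_card_filter_not (s := G.neighborFinset v)
    (fun y => χ s(v, y) = none)
  have h2 := G.degree_le_maxDegree v
  rw [G.card_neighborFinset_eq_degree] at h1
  rw [Finset.card_compl, Fintype.card_fin] at h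
  simp only [Ne] at h
  omega

end Graph

section Walk

variable {n k : ℕ} (G : SimpleGraph (Fin n)) [DecidableRel G.Adj] (χ : Coloring n k)

/-! ### Alternating walks -/

/-- One step of an alternating walk; `(x, a, b)` says that the walk is at `x`, seeks the color `a`
and then `b`. -/
def altStep (q : Fin n × Fin k × Fin k) : Option (Fin n × Fin k × Fin k) :=
  (lookup G χ q.1 q.2.1).map fun y => (y, q.2.2, q.2.1)

/-- The state of an alternating walk after `i` steps, if it is that long. -/
def altState (q : Fin n × Fin k × Fin k) : ℕ → Option (Fin n × Fin k × Fin k)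
  | 0 => some q
  | i + 1 => (altState q i).bind (altStep G χ)

/-- The number of edges of the alternating walk from the given state. -/
noncomputable def altLength (q : Fin n × Fin k × Fin k) : ℝ≥0∞ :=
  ∑' i, if (altState G χ q (i + 1)).isSome then 1 else 0

/-- The number of edges of the alternating walk, not counting the first two. -/
noncomputable def altInner (q : Fin n × Fin k × Fin k) : ℝ≥0∞ :=
  ∑' i, if (altState G χ q (i + 3)).isSome then 1 else 0

variable {G χ}

lemma altState_succ (q : Fin n × Fin k × Fin k) (i : ℕ) :
    altState G χ q (i + 1) = (altStep G χ q).bind fun q' => altState G χ q' i := by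
  induction i with
  | zero => simp [altState]
  | succ i ih =>
    rw [altState, ih]
    cases altStep G χ q <;> rfl

lemma altStep_eq_some {x y : Fin n} {a b : Fin k} (h : lookup G χ x a = some y) :
    altStep G χ (x, a, b) = some (y, b, a) := by
  simp [altStep, h]

lemma altLength_of_some {x y : Fin n} {a b : Fin k} (h : lookup G χ x a = some y) :
    altLength G χ (x, a, b) = altLength G χ (y, b, a) + 1 := by
  have e : ∀ i, altState G χ (x, a, b) (i + 1) = altState G χ (y, b, a) i := fun i => by
    rw [altState_succ, altStep_eq_some h, Option.bind_some]
  rw [altLength, tsum_eq_zero_add' ENNReal.summable, add_comm]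
  simp only [e, altLength]
  simp [altState]

lemma altLength_le (q : Fin n × Fin k × Fin k) : altLength G χ q ≤ 2 + altInner G χ q := by
  rw [altLength, tsum_eq_zero_add' ENNReal.summable, tsum_eq_zero_add' ENNReal.summable,
    ← add_assoc]
  refine add_le_add ?_ le_rfl
  rw [← one_add_one_eq_two]
  gcongr <;> split_ifs <;> simp

/-- The state after a step remembers the color just used, and in a proper coloring only one edge at
the new vertex has it; so the step can be undone. -/
lemma altStep_injective (hχ : IsPartialColoring G χ) {q q' r : Fin n × Fin k × Fin k}
    (h : altStep G χ q = some r) (h' : altStep G χ q' = some r) : q = q' := by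
  obtain ⟨x, a, b⟩ := q
  obtain ⟨x', a', b'⟩ := q'
  obtain ⟨y, hy, rfl⟩ := Option.map_eq_some_iff.1 h
  obtain ⟨y', hy', he⟩ := Option.map_eq_some_iff.1 h'
  simp only [Prod.mk.injEq] at he hy hy'
  obtain ⟨rfl, rfl, rfl⟩ := he
  have e1 := lookup_eq_some G hy
  have e2 := lookup_eq_some G hy'
  have l1 := lookup_eq_of_proper G hχ e1.1.symm (by rw [Sym2.eq_swap]; exact e1.2)
  have l2 := lookup_eq_of_proper G hχ e2.1.symm (by rw [Sym2.eq_swap]; exact e2.2)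
  rw [l1] at l2
  simp [Option.some.inj l2]

lemma altStep_target {q r : Fin n × Fin k × Fin k} (h : altStep G χ q = some r) :
    lookup G χ r.1 r.2.2 ≠ none := by
  obtain ⟨y, hy, rfl⟩ := Option.map_eq_some_iff.1 h
  have e := lookup_eq_some G hy
  exact lookup_ne_none G e.1.symm (by rw [Sym2.eq_swap]; exact e.2)

/-- Undo steps of both walks until the shorter one is back at its start `q'`. If the other had steps
left, `q'` would be the target of a step, and its last color would occur there although it is
missing. -/
lemma altState_add_unique (hχ : IsPartialColoring G χ) {q q' r : Fin n × Fin k × Fin k} {i d : ℕ}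
    (hq' : q'.2.2 ∈ missing G χ q'.1) (h' : altState G χ q' i = some r)
    (h : altState G χ q (i + d) = some r) : q = q' ∧ d = 0 := by
  induction i generalizing r with
  | zero =>
    obtain rfl : q' = r := Option.some.inj h'
    cases d with
    | zero => exact ⟨Option.some.inj h, rfl⟩
    | succ d =>
      obtain ⟨s, _, hs⟩ := Option.bind_eq_some_iff.1 h
      exact absurd ((lookup_eq_none_iff G).2 hq') (altStep_target hs)
  | succ i ih =>
    rw [Nat.add_right_comm] at h
    obtain ⟨s, hs, hsr⟩ := Option.bind_eq_some_iff.1 h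
    obtain ⟨s', hs', hsr'⟩ := Option.bind_eq_some_iff.1 h'
    obtain rfl := altStep_injective hχ hsr hsr'
    exact ih hs' hs

/-- Alternating walks that start at an endpoint of their component are disjoint paths. -/
lemma altState_unique (hχ : IsPartialColoring G χ) {q q' r : Fin n × Fin k × Fin k} {i j : ℕ}
    (hq : q.2.2 ∈ missing G χ q.1) (hq' : q'.2.2 ∈ missing G χ q'.1)
    (h : altState G χ q i = some r) (h' : altState G χ q' j = some r) : q = q' ∧ i = j := by
  rcases le_total i j with hij | hij
  · obtain ⟨d, rfl⟩ := Nat.exists_eq_add_of_le hij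
    obtain ⟨rfl, rfl⟩ := altState_add_unique hχ hq h h'
    exact ⟨rfl, rfl⟩
  · obtain ⟨d, rfl⟩ := Nat.exists_eq_add_of_le hij
    obtain ⟨rfl, rfl⟩ := altState_add_unique hχ hq' h' h
    exact ⟨rfl, rfl⟩

variable (G χ) in
/-- The possible interior edges of alternating paths: edges `xy` with a color that occurs both at
`x` and at `y`. -/
def innerSlots : Finset ((Fin n × Fin n) × Fin k) :=
  (Finset.univ.filter fun e : Fin n × Fin n => G.Adj e.1 e.2) ×ˢ Finset.univ |>.filter fun t =>
    t.2 ∈ (missing G χ t.1.1)ᶜ ∧ t.2 ∈ (missing G χ t.1.2)ᶜ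

/-- For a fixed oriented edge, the colors occurring at both ends number at most the smaller degree;
each edge has two orientations. -/
lemma card_innerSlots_le : (innerSlots G χ).card ≤ 2 * graphWeight G := by
  rw [← sum_adj_min_degree, Finset.sum_sigma']
  calc (innerSlots G χ).card
      ≤ ((Finset.univ.sigma fun x => G.neighborFinset x).sigma fun q =>
          (missing G χ q.1)ᶜ ∩ (missing G χ q.2)ᶜ).card := by
        refine Finset.card_le_card_of_injOn (fun t => ⟨⟨t.1.1, t.1.2⟩, t.2⟩) ?_ ?_
        · rintro ⟨⟨x, y⟩, b⟩ ht
          simpa [innerSlots] using ht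
        · rintro ⟨⟨x, y⟩, b⟩ - ⟨⟨x', y'⟩, b'⟩ - h
          simpa [and_assoc] using h
    _ ≤ _ := by
        rw [Finset.card_sigma]
        refine Finset.sum_le_sum fun q _ => le_min ?_ ?_
        · exact (Finset.card_le_card Finset.inter_subset_left).trans
            (card_compl_missing_le_degree G χ _)
        · exact (Finset.card_le_card Finset.inter_subset_right).trans
            (card_compl_missing_le_degree G χ _)

/-- The walk enters `x` and leaves `y` along edges of color `b`. The index i + 1 provides the edge
before xy, and the existence of state i + 3 the edge after it. -/
lemma exists_inner_slot {q : Fin n × Fin k × Fin k} {i : ℕ}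
    (h : (altState G χ q (i + 3)).isSome) :
    ∃ x y a b, altState G χ q (i + 1) = some (x, a, b) ∧ lookup G χ x a = some y ∧
      ((x, y), b) ∈ innerSlots G χ := by
  obtain ⟨r3, h3⟩ := Option.isSome_iff_exists.1 h
  obtain ⟨r2, h2, h23⟩ := Option.bind_eq_some_iff.1 h3
  obtain ⟨⟨x, a, b⟩, h1, h12⟩ := Option.bind_eq_some_iff.1 h2
  obtain ⟨r0, -, h01⟩ := Option.bind_eq_some_iff.1 h1
  obtain ⟨y, hy, rfl⟩ := Option.map_eq_some_iff.1 h12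
  obtain ⟨z, hz, -⟩ := Option.map_eq_some_iff.1 h23
  have hb := altStep_target h01
  refine ⟨x, y, a, b, h1, hy, ?_⟩
  rw [Ne, lookup_eq_none_iff] at hb
  have hb' : lookup G χ y b ≠ none := by
    simp only at hz
    simp [hz]
  rw [Ne, lookup_eq_none_iff] at hb'
  simp only at hb
  simp [innerSlots, (lookup_eq_some G hy).1, hb, hb']

/-- The interior lengths of all alternating paths add up to at most twice the weight. -/
lemma sum_altInner_le (hχ : IsPartialColoring G χ) :
    ∑ u, ∑ c₀ ∈ missing G χ u, ∑ c₁, altInner G χ (u, c₁, c₀) ≤ 2 * (graphWeight G : ℝ≥0∞) := by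
  classical
  let S : Set ((Fin n × Fin k × Fin k) × ℕ) :=
    {t | t.1.2.2 ∈ missing G χ t.1.1 ∧ (altState G χ t.1 (t.2 + 3)).isSome}
  have hS : ∑ u, ∑ c₀ ∈ missing G χ u, ∑ c₁, altInner G χ (u, c₁, c₀) = S.encard := by
    rw [← ENNReal.tsum_set_one, tsum_subtype S fun _ => (1 : ℝ≥0∞), ENNReal.tsum_prod',
      tsum_fintype, Fintype.sum_prod_type]
    refine Finset.sum_congr rfl fun u _ => ?_
    rw [Fintype.sum_prod_type, Finset.sum_comm' (t' := Finset.univ) (s' := fun _ => missing G χ u)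
      (by simp)]
    refine Finset.sum_congr rfl fun c₁ _ => ?_
    rw [← Finset.sum_filter_add_sum_filter_not Finset.univ (fun c => c ∈ missing G χ u)]
    rw [Finset.filter_univ_mem, Finset.sum_eq_zero (s := Finset.univ.filter _), add_zero]
    · refine Finset.sum_congr rfl fun c₀ hc₀ => tsum_congr fun i => ?_
      simp [S, Set.indicator, hc₀]
    · intro c₀ hc₀
      simp [S, Set.indicator, (Finset.mem_filter.1 hc₀).2]
  rw [hS]
  have hle : S.encard ≤ (innerSlots G χ : Set ((Fin n × Fin n) × Fin k)).encard := by
    have hex : ∀ t : (Fin n × Fin k × Fin k) × ℕ, t ∈ S → ∃ g : (Fin n × Fin n) × Fin k,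
        g ∈ innerSlots G χ ∧ ∃ a, altState G χ t.1 (t.2 + 1) = some (g.1.1, a, g.2) ∧
          lookup G χ g.1.1 a = some g.1.2 := by
      rintro t ht
      obtain ⟨x, y, a, b, h1, h2, h3⟩ := exists_inner_slot ht.2
      exact ⟨((x, y), b), h3, a, h1, h2⟩
    rcases S.eq_empty_or_nonempty with hS0 | ⟨t, ht⟩
    · simp [hS0]
    have : Nonempty ((Fin n × Fin n) × Fin k) := ⟨(hex t ht).choose⟩
    choose! g hg using hex
    refine Set.encard_le_encard_of_injOn (f := g) (fun t ht => (hg t ht).1) ?_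
    intro t ht t' ht' he
    obtain ⟨-, a, h1, h2⟩ := hg t ht
    obtain ⟨-, a', h1', h2'⟩ := hg t' ht'
    rw [← he] at h1' h2'
    -- The slot records only x, y and `b`; the remaining entry of the state is the color of xy.
    have ha : a = a' := by
      have e := (lookup_eq_some G h2).2
      rw [(lookup_eq_some G h2').2] at e
      exact (Option.some.inj e).symm
    subst ha
    obtain ⟨h3, h4⟩ := altState_unique hχ ht.1 ht'.1 h1 h1'
    exact Prod.ext h3 (by omega)
  rw [Set.encard_coe_eq_coe_finsetCard] at hle
  calc ((S.encard : ℕ∞) : ℝ≥0∞) ≤ (((innerSlots G χ).card : ℕ∞) : ℝ≥0∞) := by exact_mod_cast hle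
    _ ≤ 2 * (graphWeight G : ℝ≥0∞) := by exact_mod_cast card_innerSlots_le

end Walk

/-! ### Expected total cost of a Markov chain -/

lemma tsum_bind_mul {S : Type*} (μ : PMF S) (κ : S → PMF S) (V : S → ℝ≥0∞) :
    ∑' s, μ.bind κ s * V s = ∑' s, μ s * ∑' s', κ s s' * V s' := by
  simp_rw [PMF.bind_apply, ← ENNReal.tsum_mul_right, ← ENNReal.tsum_mul_left, mul_assoc]
  exact ENNReal.tsum_comm

/-- The expected total cost is at most the initial value of a potential that drops on average by
at least the cost of each step. -/
lemma tsum_cost_le_potential {S : Type*} {κ : S → PMF S} {μ : ℕ → PMF S} {s₀ : S} {Inv : S → Prop}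
    {f V : S → ℝ≥0∞} (h0 : μ 0 = PMF.pure s₀) (hμ : ∀ t, μ (t + 1) = (μ t).bind κ)
    (hInv0 : Inv s₀) (hInv : ∀ s, Inv s → ∀ s' ∈ (κ s).support, Inv s')
    (hV : ∀ s, Inv s → f s + ∑' s', κ s s' * V s' ≤ V s) :
    ∑' t, ∑' s, μ t s * f s ≤ V s₀ := by
  have hI : ∀ t, ∀ s ∈ (μ t).support, Inv s := by
    intro t
    induction t with
    | zero =>
      intro s hs
      rw [h0, PMF.support_pure, Set.mem_singleton_iff] at hs
      exact hs ▸ hInv0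
    | succ t ih =>
      intro s hs
      rw [hμ, PMF.mem_support_bind_iff] at hs
      obtain ⟨s', hs', hss'⟩ := hs
      exact hInv s' (ih s' hs') s hss'
  -- Telescoping: cost paid before time `T` plus mean potential at time `T` never exceeds the
  -- initial potential.
  have hT : ∀ T, ∑ t ∈ Finset.range T, ∑' s, μ t s * f s + ∑' s, μ T s * V s ≤ V s₀ := by
    intro T
    induction T with
    | zero =>
      rw [Finset.sum_range_zero, zero_add, h0, tsum_eq_single s₀]
      · simp
      · intro s hs
        simp [PMF.pure_apply, hs]
    | succ T ih =>
      refine le_trans ?_ ih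
      rw [Finset.sum_range_succ, add_assoc]
      refine add_le_add le_rfl ?_
      rw [hμ, tsum_bind_mul, ← ENNReal.tsum_add]
      refine ENNReal.tsum_le_tsum fun s => ?_
      rw [← mul_add]
      by_cases hs : μ T s = 0
      · simp [hs]
      · exact mul_le_mul_right (hV s (hI T s ((PMF.mem_support_iff _ _).2 hs))) _
  rw [ENNReal.tsum_eq_iSup_nat]
  exact iSup_le fun T => le_self_add.trans (hT T)

lemma tsum_ofMultiset_mul {S : Type*} (m : Multiset S) (hm : m ≠ 0)
    (V : S → ℝ≥0∞) :
    ∑' s, PMF.ofMultiset m hm s * V s = (m.map V).sum / (Multiset.card m : ℝ≥0∞) := by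
  classical
  rw [tsum_eq_sum (s := m.toFinset), Finset.sum_multiset_map_count, div_eq_mul_inv,
    Finset.sum_mul]
  · refine Finset.sum_congr rfl fun s _ => ?_
    rw [PMF.ofMultiset_apply, nsmul_eq_mul, div_eq_mul_inv]
    convert mul_right_comm _ _ _ using 4
  · intro s hs
    rw [PMF.ofMultiset_apply_of_notMem _ (by simpa using hs), zero_mul]

lemma add_div_le_of_add_mul_le {x y z c : ℝ≥0∞} (hc : c ≠ 0) (hc' : c ≠ ∞)
    (h : y + c * x ≤ c * z) : x + y / c ≤ z := by
  rw [← ENNReal.mul_le_mul_iff_right hc hc', mul_add, ENNReal.mul_div_cancel hc hc', add_comm]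
  exact h

/-! ### Mean costs over the hash parameters -/

/-- The mean of `f a b` over `a, b < p` is at most `c`. -/
def MeanLE (p : ℕ) (f : ℕ → ℕ → ℕ) (c : ℕ) : Prop :=
  ∑ a : Fin p, ∑ b : Fin p, f a b ≤ c * p ^ 2

lemma MeanLE.const (p c : ℕ) : MeanLE p (fun _ _ => c) c := by
  simp only [MeanLE, Finset.sum_const, Finset.card_univ, Fintype.card_fin, smul_eq_mul]
  exact le_of_eq (by ring)

lemma MeanLE.add {p : ℕ} {f g : ℕ → ℕ → ℕ} {c d : ℕ} (hf : MeanLE p f c) (hg : MeanLE p g d) :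
    MeanLE p (fun a b => f a b + g a b) (c + d) := by
  simp only [MeanLE, Finset.sum_add_distrib, add_mul] at *
  exact add_le_add hf hg

lemma MeanLE.mono {p : ℕ} {f : ℕ → ℕ → ℕ} {c d : ℕ} (hf : MeanLE p f c) (h : c ≤ d) :
    MeanLE p f d :=
  le_trans hf (Nat.mul_le_mul_right _ h)

section

variable {n k : ℕ} {G : SimpleGraph (Fin n)} [DecidableRel G.Adj] {p : ℕ}

/-- One unit plus a bucket of mean size at most three; colors are valid keys because they are at
most Δ < n < p. -/
lemma meanLE_probe (hk : k = G.maxDegree + 1) (hp : p.Prime) (hn : n < p) (χ : Coloring n k)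
    (v : Fin n) (c : Fin k) : MeanLE p (fun a b => probe (hash p a b) G χ v c) 4 := by
  have : Nonempty (Fin n) := ⟨v⟩
  have hΔ : G.maxDegree < n := by simpa using G.maxDegree_lt_card_verts
  have hd := G.degree_le_maxDegree v
  refine ((MeanLE.const p 1).add (d := 3) ?_).mono le_rfl
  have h := sum_bucket_le (s := G.degree v) (y := c.val) hp
    ((missing G χ v)ᶜ.map Fin.valEmbedding) ?_ (by omega) ?_ (by omega)
  · refine le_trans (le_of_eq ?_) h
    refine Finset.sum_congr rfl fun a _ => Finset.sum_congr rfl fun b _ => ?_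
    rw [Finset.filter_map, Finset.card_map]
    rfl
  · intro x hx
    obtain ⟨c', -, rfl⟩ := Finset.mem_map.1 hx
    have := c'.2
    simp only [Fin.valEmbedding_apply]
    omega
  · rw [Finset.card_map]
    exact card_compl_missing_le_degree G χ v

lemma length_le_degree {u : Fin n} {F : List (Fin n)} (hF : F.Nodup) (hu : ∀ x ∈ F, G.Adj u x) :
    F.length ≤ G.degree u := by
  rw [← List.toFinset_card_of_nodup hF, ← G.card_neighborFinset_eq_degree]
  exact Finset.card_le_card fun x hx => by simpa using hu x (List.mem_toFinset.1 hx)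

lemma meanLE_leafProbe (hp : p.Prime) (hn : n < p) {u : Fin n} {F : List (Fin n)} (hF : F.Nodup)
    (hu : ∀ x ∈ F, G.Adj u x) (y : Fin n) :
    MeanLE p (fun a b => leafProbe (hash p a b) G u F y) 4 := by
  have hd := G.degree_lt_card_verts u
  rw [Fintype.card_fin] at hd
  refine ((MeanLE.const p 1).add (d := 3) ?_).mono le_rfl
  have h := sum_bucket_le (s := G.degree u) (y := y.val) hp
    (F.toFinset.map Fin.valEmbedding) ?_ (by omega) ?_ (by omega)
  · refine le_trans (le_of_eq ?_) h
    refine Finset.sum_congr rfl fun a _ => Finset.sum_congr rfl fun b _ => ?_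
    simp only []
    rw [Finset.filter_map, Finset.card_map, List.countP_eq_length_filter,
      ← List.toFinset_card_of_nodup (hF.filter _), List.toFinset_filter]
    simp
  · intro x hx
    obtain ⟨c', -, rfl⟩ := Finset.mem_map.1 hx
    have := c'.2
    simp only [Fin.valEmbedding_apply]
    omega
  · rw [Finset.card_map, List.toFinset_card_of_nodup hF]
    exact length_le_degree hF hu

lemma meanLE_recolorCost (hk : k = G.maxDegree + 1) (hp : p.Prime) (hn : n < p)
    (χ : Coloring n k) (x y : Fin n) (o : Option (Fin k)) :
    MeanLE p (fun a b => recolorCost (hash p a b) G χ x y o) 8 := by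
  cases o with
  | none =>
    simp only [recolorCost]
    exact (MeanLE.const p 0).mono (by norm_num)
  | some c =>
    simp only [recolorCost]
    exact ((meanLE_probe hk hp hn χ x c).add (meanLE_probe hk hp hn χ y c)).mono le_rfl

/-! ### Invariant, cost bound and potential -/

/-- An invariant of the configurations of the algorithm with input `χ₀`. -/
def Reachable (G : SimpleGraph (Fin n)) [DecidableRel G.Adj] (χ₀ : Coloring n k) :
    Config n k → Prop
  | ⟨χ, .pickEdge⟩ => χ = χ₀
  | ⟨χ, .initFan u v⟩ => χ = χ₀ ∧ G.Adj u v
  | ⟨χ, .growFan u F x⟩ => χ = χ₀ ∧ (F ++ [x]).Nodup ∧ ∀ y ∈ F ++ [x], G.Adj u y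
  | ⟨χ, .chooseColor u F _⟩ => χ = χ₀ ∧ F.length ≤ G.degree u
  | ⟨χ, .scan u F _ i A⟩ => χ = χ₀ ∧ F.length ≤ G.degree u ∧ i ≤ k ∧ A.Nodup ∧
      ∀ c : Fin k, c ∈ A ↔ c.val < i ∧ c ∈ missing G χ u
  | ⟨χ, .sample u F _⟩ => χ = χ₀ ∧ F.length ≤ G.degree u ∧ 2 * G.degree u ≤ G.maxDegree
  | ⟨χ, .test u F _ _⟩ => χ = χ₀ ∧ F.length ≤ G.degree u ∧ 2 * G.degree u ≤ G.maxDegree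
  | _ => True

/-- An upper bound on the mean cost of the step that leaves a configuration. -/
def costBound (G : SimpleGraph (Fin n)) [DecidableRel G.Adj] : Config n k → ℕ
  | ⟨_, .pickEdge⟩ => 1
  | ⟨_, .initFan u _⟩ => 2 + G.degree u
  -- One unit and at most three table accesses of mean cost 4. A recoloring accesses two tables,
  -- hence 9 = 1 + 8 and 17 = 1 + 8 + 8 below.
  | ⟨_, .growFan _ _ _⟩ => 13
  | ⟨_, .chooseColor _ _ _⟩ => 1
  | ⟨_, .scan _ _ _ _ _⟩ => 5
  | ⟨_, .sample _ _ _⟩ => 1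
  | ⟨_, .test _ _ _ _⟩ => 5
  | ⟨_, .walk _ _ _ _ _ _ _ _⟩ => 5
  | ⟨_, .extend _ F _ _ _ _⟩ => 5 + F.length
  | ⟨_, .erase _ _ _ _ _ _⟩ => 9
  | ⟨_, .paint _ _ _ _ _ _⟩ => 9
  | ⟨_, .shift _ _ _⟩ => 17
  | ⟨_, .done⟩ => 0

/-- The mean, over the colors `c₀` missing at `u`, of the total interior length of the alternating
paths that start at `u` with any color followed by `c₀`. -/
noncomputable def meanInner (G : SimpleGraph (Fin n)) [DecidableRel G.Adj] (χ : Coloring n k)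
    (u : Fin n) : ℝ≥0∞ :=
  (∑ c₀ ∈ missing G χ u, ∑ c₁, altInner G χ (u, c₁, c₀)) / ((missing G χ u).card : ℝ≥0∞)

/-- A bound on the expected remaining running time. -/
noncomputable def potential {χ₀ : Coloring n k} (ch : Choices G χ₀) : Config n k → ℝ≥0∞
  -- With d = d(u), 42d + 124 is 2 + d for the table of leaves, 13(d + 1) for growing the fan and
  -- 28d + 109 for the rest.
  | ⟨χ, .pickEdge⟩ => 1 + (∑ e ∈ uncolored G χ,
      (((42 * G.degree (ch.low e) + 124 : ℕ) : ℝ≥0∞) + 23 * meanInner G χ (ch.low e))) /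
        ((uncolored G χ).card : ℝ≥0∞)
  | ⟨χ, .initFan u _⟩ => ((42 * G.degree u + 124 : ℕ) : ℝ≥0∞) + 23 * meanInner G χ u
  | ⟨χ, .growFan u F _⟩ =>
      ((13 * (G.degree u + 1 - F.length) + 28 * G.degree u + 109 : ℕ) : ℝ≥0∞)
        + 23 * meanInner G χ u
  | ⟨χ, .chooseColor u _ _⟩ => ((28 * G.degree u + 109 : ℕ) : ℝ≥0∞) + 23 * meanInner G χ u
  | ⟨χ, .scan u _ _ i _⟩ =>
      ((5 * (k + 1 - i) + 18 * G.degree u + 91 : ℕ) : ℝ≥0∞) + 23 * meanInner G χ u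
  | ⟨χ, .sample u _ _⟩ => ((18 * G.degree u + 103 : ℕ) : ℝ≥0∞) + 23 * meanInner G χ u
  | ⟨χ, .test u F c₁ c⟩ => 5 + if c ∈ missing G χ u
      then ((18 * F.length + 45 : ℕ) : ℝ≥0∞) + 23 * altLength G χ (u, c₁, c)
      else ((18 * G.degree u + 103 : ℕ) : ℝ≥0∞) + 23 * meanInner G χ u
  -- An edge already found still costs 9 + 9 to erase and paint, and an edge yet to be found 5 more,
  -- hence 23. A leaf costs 1 in the search and 17 in the shift. The constant 45 = 5 + 5 + 9 + 9 +
  -- 17 pays for the last walk step, the base cost of `extend`, and the closing steps of the two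
  -- passes and the shift.
  | ⟨χ, .walk _ F _ _ x a b P⟩ =>
      ((18 * P.length + 18 * F.length + 45 : ℕ) : ℝ≥0∞) + 23 * altLength G χ (x, a, b)
  | ⟨_, .extend _ F _ _ P _⟩ => ((18 * P.length + 18 * F.length + 40 : ℕ) : ℝ≥0∞)
  | ⟨_, .erase _ R _ _ P Q⟩ =>
      ((9 * (Q.length + 1) + 9 * (P.length + 1) + 17 * (R.length + 1) : ℕ) : ℝ≥0∞)
  | ⟨_, .paint _ R _ _ _ Q⟩ => ((9 * (Q.length + 1) + 17 * (R.length + 1) : ℕ) : ℝ≥0∞)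
  | ⟨_, .shift _ R _⟩ => ((17 * (R.length + 1) : ℕ) : ℝ≥0∞)
  | ⟨_, .done⟩ => 0

variable {χ₀ : Coloring n k} {ch : Choices G χ₀}

/-- The invariant matters only for the fan: its leaves are distinct neighbors of `u`, so their table
is not overfull. -/
lemma meanLE_cost (hk : k = G.maxDegree + 1) (hp : p.Prime) (hn : n < p) {s : Config n k}
    (hs : Reachable G χ₀ s) :
    MeanLE p (fun a b => cost (hash p a b) G ch s) (costBound G s) := by
  have hpr := meanLE_probe hk hp hn
  have hrc := meanLE_recolorCost hk hp hn
  have hc := MeanLE.const p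
  obtain ⟨χ, ctl⟩ := s
  cases ctl with
  | pickEdge =>
    simp only [cost, costBound]
    exact hc 1
  | initFan u v =>
    simp only [cost, costBound, leafProbe, List.countP_nil]
    exact (hc _).mono (by omega)
  | growFan u F x =>
    obtain ⟨rfl, hF, hu⟩ := hs
    have h : MeanLE p (fun a b => match lookup G χ u (ch.pick u F x) with
        | none => 0
        | some y => leafProbe (hash p a b) G u (F ++ [x]) y
          + leafProbe (hash p a b) G u (F ++ [x]) y) 8 := by
      cases lookup G χ u (ch.pick u F x) with
      | none => exact (hc 0).mono (by norm_num)
      | some y => exact ((meanLE_leafProbe hp hn hF hu y).add (meanLE_leafProbe hp hn hF hu y)).mono le_rfl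
    simp only [cost, costBound]
    exact (((hc 1).add (hpr χ u (ch.pick u F x))).add h).mono le_rfl
  | chooseColor u F c₁ =>
    simp only [cost, costBound]
    exact hc 1
  | scan u F c₁ i A =>
    simp only [cost, costBound]
    refine MeanLE.mono ((hc 1).add (d := 4) ?_) le_rfl
    split_ifs with hi
    · exact hpr χ u ⟨i, hi⟩
    · exact (hc 0).mono (by norm_num)
  | sample u F c₁ =>
    simp only [cost, costBound]
    exact hc 1
  | test u F c₁ c =>
    simp only [cost, costBound]
    exact ((hc 1).add (hpr χ u c)).mono le_rfl
  | walk u F c₀ c₁ x a b P =>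
    simp only [cost, costBound]
    exact ((hc 1).add (hpr χ x a)).mono le_rfl
  | extend u F c₀ c₁ P w =>
    simp only [cost, costBound]
    exact (((hc 1).add (hpr χ u c₁)).add (hc F.length)).mono le_rfl
  | erase u R c₀ c₁ P Q =>
    cases Q with
    | nil =>
      simp only [cost, costBound]
      exact (hc 1).mono (by norm_num)
    | cons q Q =>
      simp only [cost, costBound]
      exact ((hc 1).add (hrc χ q.1 q.2 (χ s(q.1, q.2)))).mono le_rfl
  | paint u R c₁ a b Q =>
    cases Q with
    | nil =>
      simp only [cost, costBound]
      exact (hc 1).mono (by norm_num)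
    | cons q Q =>
      simp only [cost, costBound]
      exact ((hc 1).add (hrc χ q.1 q.2 (some a))).mono le_rfl
  | shift u R c₁ =>
    match R with
    | [] =>
      simp only [cost, costBound]
      exact (hc 1).mono (by norm_num)
    | [x] =>
      simp only [cost, costBound]
      exact ((hc 1).add (hrc χ u x (some c₁))).mono (by norm_num)
    | x :: y :: R =>
      simp only [cost, costBound]
      exact (((hc 1).add (hrc χ u y _)).add (hrc _ u x _)).mono le_rfl
  | done =>
    simp only [cost, costBound]
    exact hc 0

lemma reachable_next {s : Config n k} (hs : Reachable G χ₀ s) :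
    ∀ s' ∈ next G ch s, Reachable G χ₀ s' := by
  obtain ⟨χ, ctl⟩ := s
  intro s' hs'
  cases ctl with
  | pickEdge =>
    simp only [next] at hs'
    obtain ⟨e, he, rfl⟩ := Multiset.mem_map.1 hs'
    refine ⟨hs, ?_⟩
    have := (Finset.mem_filter.1 (show e ∈ uncolored G χ from he)).1
    rwa [SimpleGraph.mem_edgeFinset, ← ch.ends_eq e, SimpleGraph.mem_edgeSet] at this
  | initFan u v =>
    obtain rfl := Multiset.mem_singleton.1 hs'
    exact ⟨hs.1, by simp, by simpa using hs.2⟩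
  | growFan u F x =>
    obtain ⟨rfl, hF, hu⟩ := hs
    simp only [next] at hs'
    cases hl : lookup G χ u (ch.pick u F x) with
    | none =>
      simp only [hl] at hs'
      obtain rfl := Multiset.mem_singleton.1 hs'
      exact ⟨rfl, length_le_degree hF hu⟩
    | some y =>
      simp only [hl] at hs'
      split_ifs at hs' with hy
      · obtain rfl := Multiset.mem_singleton.1 hs'
        exact ⟨rfl, length_le_degree hF hu⟩
      · obtain rfl := Multiset.mem_singleton.1 hs'
        refine ⟨rfl, ?_, ?_⟩
        · rw [List.nodup_append_comm]
          exact List.nodup_cons.2 ⟨hy, hF⟩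
        · intro z hz
          rcases List.mem_append.1 hz with hz | hz
          · exact hu z hz
          · rw [List.mem_singleton.1 hz]
            exact (lookup_eq_some G hl).1
  | chooseColor u F c₁ =>
    obtain ⟨rfl, hF⟩ := hs
    simp only [next] at hs'
    split_ifs at hs' with h
    · obtain rfl := Multiset.mem_singleton.1 hs'
      exact ⟨rfl, hF, Nat.zero_le _, List.nodup_nil, by simp⟩
    · obtain rfl := Multiset.mem_singleton.1 hs'
      exact ⟨rfl, hF, not_lt.1 h⟩
  | scan u F c₁ i A =>
    obtain ⟨rfl, hF, hik, hA, hAi⟩ := hs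
    simp only [next] at hs'
    split_ifs at hs' with hi
    · have hlt : ∀ c : Fin k, c.val < i + 1 ↔ c.val < i ∨ c = ⟨i, hi⟩ := by
        intro c
        rw [Fin.ext_iff]
        simp only
        omega
      cases hl : lookup G χ u ⟨i, hi⟩ with
      | none =>
        simp only [hl] at hs'
        obtain rfl := Multiset.mem_singleton.1 hs'
        rw [lookup_eq_none_iff] at hl
        refine ⟨rfl, hF, hi, ?_, ?_⟩
        · rw [List.nodup_append_comm]
          refine List.nodup_cons.2 ⟨fun h => ?_, by simpa using hA⟩
          exact absurd ((hAi _).1 h).1 (lt_irrefl _)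
        · intro c
          rw [List.mem_append, hAi, List.mem_singleton, hlt]
          constructor
          · rintro (h | rfl)
            · exact ⟨Or.inl h.1, h.2⟩
            · exact ⟨Or.inr rfl, hl⟩
          · rintro ⟨h | rfl, h'⟩
            · exact Or.inl ⟨h, h'⟩
            · exact Or.inr rfl
      | some y =>
        simp only [hl] at hs'
        obtain rfl := Multiset.mem_singleton.1 hs'
        refine ⟨rfl, hF, hi, hA, ?_⟩
        intro c
        rw [hAi, hlt]
        constructor
        · exact fun h => ⟨Or.inl h.1, h.2⟩
        · rintro ⟨h | rfl, h'⟩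
          · exact ⟨h, h'⟩
          · rw [(lookup_eq_none_iff G).2 h'] at hl
            cases hl
    · obtain ⟨c, -, rfl⟩ := Multiset.mem_map.1 hs'
      trivial
  | sample u F c₁ =>
    simp only [next] at hs'
    obtain ⟨c, -, rfl⟩ := Multiset.mem_map.1 hs'
    exact hs
  | test u F c₁ c =>
    simp only [next] at hs'
    split at hs' <;> obtain rfl := Multiset.mem_singleton.1 hs'
    · trivial
    · exact hs
  | walk u F c₀ c₁ x a b P =>
    simp only [next] at hs'
    split at hs' <;> obtain rfl := Multiset.mem_singleton.1 hs' <;> trivial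
  | extend u F c₀ c₁ P w =>
    simp only [next] at hs'
    split at hs'
    · obtain rfl := Multiset.mem_singleton.1 hs'
      trivial
    · split_ifs at hs' <;> obtain rfl := Multiset.mem_singleton.1 hs' <;> trivial
  | erase u R c₀ c₁ P Q => cases Q <;> obtain rfl := Multiset.mem_singleton.1 hs' <;> trivial
  | paint u R c₁ a b Q => cases Q <;> obtain rfl := Multiset.mem_singleton.1 hs' <;> trivial
  | shift u R c₁ =>
    match R with
    | [] => obtain rfl := Multiset.mem_singleton.1 hs'; trivial
    | [x] => obtain rfl := Multiset.mem_singleton.1 hs'; trivial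
    | x :: y :: R => obtain rfl := Multiset.mem_singleton.1 hs'; trivial
  | done => obtain rfl := Multiset.mem_singleton.1 hs'; trivial

end

/-! ### The drift inequality for the potential -/

section

variable {n k : ℕ} {G : SimpleGraph (Fin n)} [DecidableRel G.Adj] {χ₀ : Coloring n k}
  {ch : Choices G χ₀}

lemma missing_card_pos (hk : k = G.maxDegree + 1) (χ : Coloring n k) (u : Fin n) :
    0 < (missing G χ u).card := by
  have h1 := le_card_missing_add_degree G χ u
  have h2 := G.degree_le_maxDegree u
  omega

lemma card_mul_meanInner (hk : k = G.maxDegree + 1) (χ : Coloring n k) (u : Fin n) :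
    ((missing G χ u).card : ℝ≥0∞) * meanInner G χ u =
      ∑ c₀ ∈ missing G χ u, ∑ c₁, altInner G χ (u, c₁, c₀) :=
  ENNReal.mul_div_cancel (by exact_mod_cast (missing_card_pos hk χ u).ne')
    (ENNReal.natCast_ne_top _)

/-- The two edges outside the interior account for 91 = 45 + 2 · 23. As `c₁` depends on the fan, its
path is bounded by the sum over all colors, which makes the average over `c₀` equal to `meanInner`.
-/
lemma sum_potential_walk_le (hk : k = G.maxDegree + 1) (χ : Coloring n k) (u : Fin n)
    {F : List (Fin n)} (hF : F.length ≤ G.degree u) (c₁ : Fin k) :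
    ∑ c ∈ missing G χ u,
        (((18 * F.length + 45 : ℕ) : ℝ≥0∞) + 23 * altLength G χ (u, c₁, c)) ≤
      ((missing G χ u).card : ℝ≥0∞) *
        (((18 * G.degree u + 91 : ℕ) : ℝ≥0∞) + 23 * meanInner G χ u) := by
  rw [mul_add, mul_left_comm, card_mul_meanInner hk, Finset.mul_sum, ← nsmul_eq_mul,
    ← Finset.sum_const, ← Finset.sum_add_distrib]
  refine Finset.sum_le_sum fun c _ => ?_
  calc ((18 * F.length + 45 : ℕ) : ℝ≥0∞) + 23 * altLength G χ (u, c₁, c)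
      ≤ ((18 * G.degree u + 45 : ℕ) : ℝ≥0∞) + 23 * (2 + altInner G χ (u, c₁, c)) := by
        gcongr
        exact altLength_le _
    _ = ((18 * G.degree u + 91 : ℕ) : ℝ≥0∞) + 23 * altInner G χ (u, c₁, c) := by
        push_cast
        ring
    _ ≤ _ := by
        gcongr
        exact Finset.single_le_sum (f := fun c₁ => altInner G χ (u, c₁, c))
          (fun _ _ => zero_le) (Finset.mem_univ c₁)

lemma cast_add_le {a c b : ℕ} (h : a + c ≤ b) (X : ℝ≥0∞) :
    (a : ℝ≥0∞) + X + (c : ℝ≥0∞) ≤ (b : ℝ≥0∞) + X := by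
  rw [add_right_comm]
  gcongr
  exact_mod_cast h

/-- The potential drops on average by at least the cost bound. -/
def Drift (ch : Choices G χ₀) (s : Config n k) : Prop :=
  next G ch s ≠ 0 ∧
    ((next G ch s).map (potential ch)).sum + Multiset.card (next G ch s) * (costBound G s : ℝ≥0∞)
      ≤ Multiset.card (next G ch s) * potential ch s

lemma Drift.of_singleton {s s' : Config n k} (h : next G ch s = {s'})
    (hle : potential ch s' + (costBound G s : ℝ≥0∞) ≤ potential ch s) : Drift ch s := by
  rw [Drift, h]
  simpa using hle

lemma drift_scan (hk : k = G.maxDegree + 1) {χ : Coloring n k} {u : Fin n} {F : List (Fin n)}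
    {c₁ : Fin k} {i : ℕ} {A : List (Fin k)} (hs : Reachable G χ₀ ⟨χ, .scan u F c₁ i A⟩) :
    Drift ch ⟨χ, .scan u F c₁ i A⟩ := by
  obtain ⟨rfl, hF, hik, hA, hAi⟩ := hs
  by_cases hi : i < k
  · obtain ⟨A', hA'⟩ : ∃ A', next G ch ⟨χ, .scan u F c₁ i A⟩ = {⟨χ, .scan u F c₁ (i + 1) A'⟩} := by
      simp only [next, hi, dite_true]
      split
      · exact ⟨_, rfl⟩
      · exact ⟨_, rfl⟩
    refine Drift.of_singleton hA' ?_
    simp only [potential, costBound]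
    exact cast_add_le (by omega) _
  -- The scan is complete, so a uniform entry of `A` is a uniform color of M(u).
  · have hAM : (A : Multiset (Fin k)) = (missing G χ u).val := by
      rw [← Multiset.coe_eq_coe.2 (List.Perm.of_eq hA.dedup), ← List.toFinset_val]
      congr 1
      ext c
      rw [List.mem_toFinset, hAi]
      have := c.2
      constructor
      · exact fun h => h.2
      · exact fun h => ⟨by omega, h⟩
    have hnext : next G ch ⟨χ, .scan u F c₁ i A⟩ = (missing G χ u).val.map
        fun c => ⟨χ, .walk u F c c₁ u c₁ c []⟩ := by
      simp only [next, hi, dite_false, hAM]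
    refine ⟨?_, ?_⟩
    · rw [hnext, Ne, Multiset.map_eq_zero, Finset.val_eq_zero]
      exact Finset.card_pos.1 (missing_card_pos hk χ u) |>.ne_empty
    · rw [hnext, Multiset.map_map, Multiset.card_map, Finset.card_val]
      have h := sum_potential_walk_le hk χ u hF c₁
      calc _ ≤ ((missing G χ u).card : ℝ≥0∞) *
              (((18 * G.degree u + 91 : ℕ) : ℝ≥0∞) + 23 * meanInner G χ u) +
              ((missing G χ u).card : ℝ≥0∞) * ((5 : ℕ) : ℝ≥0∞) := by
            refine add_le_add (le_trans (le_of_eq ?_) h) le_rfl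
            refine Finset.sum_congr rfl fun c _ => ?_
            simp [potential]
        _ ≤ _ := by
            rw [← mul_add]
            gcongr
            simp only [potential]
            exact cast_add_le (by omega) _

/-- A trial costs 1 + 5 = 6 on average over the hash parameters and succeeds with probability at
least 1/2, so the surplus 103 - 91 = 12 pays for the expected trials. -/
lemma drift_sample (hk : k = G.maxDegree + 1) {χ : Coloring n k} {u : Fin n} {F : List (Fin n)}
    {c₁ : Fin k} (hs : Reachable G χ₀ ⟨χ, .sample u F c₁⟩) :
    Drift ch ⟨χ, .sample u F c₁⟩ := by
  obtain ⟨rfl, hF, hd⟩ := hs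
  have hm := le_card_missing_add_degree G χ u
  have hnext : next G ch ⟨χ, .sample u F c₁⟩ = (Finset.univ : Finset (Fin k)).val.map
      fun c => ⟨χ, .test u F c₁ c⟩ := rfl
  have hcard : (missing G χ u).card + (Finset.univ.filter fun c => c ∉ missing G χ u).card = k := by
    have := Finset.card_filter_add_card_filter_not (s := (Finset.univ : Finset (Fin k)))
      (fun c => c ∈ missing G χ u)
    rwa [Finset.filter_univ_mem, Finset.card_univ, Fintype.card_fin] at this
  refine ⟨?_, ?_⟩
  · rw [hnext, Ne, Multiset.map_eq_zero, Finset.val_eq_zero]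
    exact (Finset.univ_nonempty_iff.2 ⟨c₁⟩).ne_empty
  · rw [hnext, Multiset.map_map, Multiset.card_map, Finset.card_val, Finset.card_univ,
      Fintype.card_fin]
    have h := sum_potential_walk_le hk χ u hF c₁
    have e : (Multiset.map (potential ch ∘ fun c => (⟨χ, .test u F c₁ c⟩ : Config n k))
        (Finset.univ : Finset (Fin k)).val).sum = ∑ c : Fin k, (5 + if c ∈ missing G χ u
          then ((18 * F.length + 45 : ℕ) : ℝ≥0∞) + 23 * altLength G χ (u, c₁, c)
          else ((18 * G.degree u + 103 : ℕ) : ℝ≥0∞) + 23 * meanInner G χ u) := rfl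
    rw [e, Finset.sum_add_distrib, Finset.sum_ite, Finset.filter_univ_mem, Finset.sum_const,
      Finset.sum_const, Finset.card_univ, Fintype.card_fin]
    simp only [potential, costBound, nsmul_eq_mul]
    generalize (Finset.univ.filter fun c => c ∉ missing G χ u).card = N at *
    generalize (missing G χ u).card = m at *
    generalize 23 * meanInner G χ u = X at *
    calc _ ≤ (k : ℝ≥0∞) * 5 + ((m : ℝ≥0∞) * (((18 * G.degree u + 91 : ℕ) : ℝ≥0∞) + X) +
          (N : ℝ≥0∞) * (((18 * G.degree u + 103 : ℕ) : ℝ≥0∞) + X)) + (k : ℝ≥0∞) * (1 : ℕ) := by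
          gcongr
      _ = ((6 * (m + N) + m * (18 * G.degree u + 91) + N * (18 * G.degree u + 103) : ℕ) : ℝ≥0∞)
            + ((m + N : ℕ) : ℝ≥0∞) * X := by
          rw [← hcard]
          push_cast
          ring
      _ ≤ ((k * (18 * G.degree u + 103) : ℕ) : ℝ≥0∞) + (k : ℝ≥0∞) * X := by
          rw [← hcard]
          gcongr
          -- From N ≤ d(u), 2d(u) ≤ Δ and m + N = Δ + 1.
          have : N ≤ m := by omega
          nlinarith
      _ = _ := by
          push_cast
          ring

lemma drift (hk : k = G.maxDegree + 1) (hl : (uncolored G χ₀).card ≠ 0) {s : Config n k}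
    (hs : Reachable G χ₀ s) : Drift ch s := by
  obtain ⟨χ, ctl⟩ := s
  cases ctl with
  | pickEdge =>
    obtain rfl := hs
    have hnext : next G ch ⟨χ, .pickEdge⟩ = (uncolored G χ).val.map
      fun e => ⟨χ, .initFan (ch.low e) (ch.high e)⟩ := rfl
    refine ⟨?_, ?_⟩
    · rw [hnext, Ne, Multiset.map_eq_zero, Finset.val_eq_zero]
      exact fun h => hl (Finset.card_eq_zero.2 h)
    · rw [hnext, Multiset.map_map, Multiset.card_map, Finset.card_val]
      simp only [potential, costBound]
      rw [mul_add, ENNReal.mul_div_cancel (by exact_mod_cast hl) (ENNReal.natCast_ne_top _),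
        add_comm, Nat.cast_one]
      rfl
  | initFan u v =>
    obtain ⟨rfl, hv⟩ := hs
    refine Drift.of_singleton rfl ?_
    simp only [potential, costBound, List.length_nil]
    exact cast_add_le (by omega) _
  | growFan u F x =>
    obtain ⟨rfl, hF, hu⟩ := hs
    have hlen := length_le_degree hF hu
    rw [List.length_append, List.length_singleton] at hlen
    have hfinish : next G ch ⟨χ, .growFan u F x⟩ = {⟨χ, .chooseColor u (F ++ [x]) (ch.pick u F x)⟩} →
        Drift ch ⟨χ, .growFan u F x⟩ := by
      intro h
      refine Drift.of_singleton h ?_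
      simp only [potential, costBound]
      exact cast_add_le (by omega) _
    cases hy : lookup G χ u (ch.pick u F x) with
    | none => exact hfinish (by simp only [next, hy])
    | some y =>
      by_cases hyF : y ∈ F ++ [x]
      · exact hfinish (by simp only [next, hy, if_pos hyF])
      · refine Drift.of_singleton (s' := ⟨χ, .growFan u (F ++ [x]) y⟩)
          (by simp only [next, hy, if_neg hyF]) ?_
        simp only [potential, costBound, List.length_append, List.length_singleton]
        exact cast_add_le (by omega) _
  | chooseColor u F c₁ =>
    obtain ⟨rfl, hF⟩ := hs
    -- Here k = Δ + 1 ≤ 2d(u), so scanning at 5 per color fits into the 10d(u) by which 28d(u)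
    -- exceeds 18d(u).
    by_cases h : G.maxDegree < 2 * G.degree u
    · refine Drift.of_singleton (s' := ⟨χ, .scan u F c₁ 0 []⟩) (by simp only [next, if_pos h]) ?_
      simp only [potential, costBound]
      exact cast_add_le (by omega) _
    · refine Drift.of_singleton (s' := ⟨χ, .sample u F c₁⟩) (by simp only [next, if_neg h]) ?_
      simp only [potential, costBound]
      exact cast_add_le (by omega) _
  | scan u F c₁ i A => exact drift_scan hk hs
  | sample u F c₁ => exact drift_sample hk hs
  | test u F c₁ c =>
    cases hl : lookup G χ u c with
    | none =>
      refine Drift.of_singleton (s' := ⟨χ, .walk u F c c₁ u c₁ c []⟩)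
        (by simp only [next, hl]) ?_
      rw [lookup_eq_none_iff] at hl
      simp [potential, costBound, if_pos hl, add_comm]
    | some y =>
      refine Drift.of_singleton (s' := ⟨χ, .sample u F c₁⟩) (by simp only [next, hl]) ?_
      have hc : c ∉ missing G χ u := by
        rw [← lookup_eq_none_iff, hl]
        exact Option.some_ne_none y
      simp [potential, costBound, if_neg hc, add_comm]
  | walk u F c₀ c₁ x a b P =>
    cases hl : lookup G χ x a with
    | none =>
      refine Drift.of_singleton (s' := ⟨χ, .extend u F c₀ c₁ P x⟩) (by simp only [next, hl]) ?_
      simp only [potential, costBound]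
      refine le_trans ?_ le_self_add
      exact_mod_cast le_rfl
    | some y =>
      refine Drift.of_singleton (s' := ⟨χ, .walk u F c₀ c₁ y b a (P ++ [(x, y)])⟩)
        (by simp only [next, hl]) ?_
      simp only [potential, costBound, altLength_of_some hl, List.length_append,
        List.length_singleton]
      refine le_of_eq ?_
      push_cast
      ring
  | extend u F c₀ c₁ P w =>
    have herase : ∀ R : List (Fin n), R.length ≤ F.length →
        next G ch ⟨χ, .extend u F c₀ c₁ P w⟩ = {⟨χ, .erase u R c₀ c₁ P P⟩} →
        Drift ch ⟨χ, .extend u F c₀ c₁ P w⟩ := by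
      intro R hR h
      refine Drift.of_singleton h ?_
      simp only [potential, costBound]
      norm_cast
      omega
    cases hl : lookup G χ u c₁ with
    | none =>
      refine Drift.of_singleton (s' := ⟨χ, .shift u F c₁⟩) (by simp only [next, hl]) ?_
      simp only [potential, costBound]
      norm_cast
      omega
    | some y =>
      by_cases hw : (F.takeWhile fun x => decide (x ≠ y)).getLast? ≠ some w
      · exact herase _ (List.takeWhile_prefix fun x => decide (x ≠ y)).length_le (by simp only [next, hl, if_pos hw])
      · exact herase _ le_rfl (by simp only [next, hl, if_neg hw])
  | erase u R c₀ c₁ P Q =>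
    cases Q with
    | nil =>
      refine Drift.of_singleton rfl ?_
      simp only [potential, costBound, List.length_nil]
      norm_cast
      omega
    | cons q Q =>
      refine Drift.of_singleton rfl ?_
      simp only [potential, costBound, List.length_cons]
      norm_cast
      omega
  | paint u R c₁ a b Q =>
    cases Q with
    | nil =>
      refine Drift.of_singleton rfl ?_
      simp only [potential, costBound, List.length_nil]
      norm_cast
      omega
    | cons q Q =>
      refine Drift.of_singleton rfl ?_
      simp only [potential, costBound, List.length_cons]
      norm_cast
      omega
  | shift u R c₁ =>
    match R with
    | [] =>
      refine Drift.of_singleton rfl ?_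
      simp [potential, costBound]
    | [x] =>
      refine Drift.of_singleton rfl ?_
      simp only [potential, costBound, List.length_cons]
      norm_num
    | x :: y :: R =>
      refine Drift.of_singleton rfl ?_
      simp only [potential, costBound, List.length_cons]
      norm_cast
  | done =>
    refine Drift.of_singleton rfl ?_
    simp [potential, costBound]

end

/-! ### From the potential to the weight bound -/

section

variable {n k : ℕ} {G : SimpleGraph (Fin n)} [DecidableRel G.Adj] {p : ℕ} {χ : Coloring n k}

/-- The law of the run does not involve the hash parameters, so averaging over them affects only the
step costs. -/
lemma expectedTime_eq (ch : Choices G χ) : expectedTime p G ch = ∑' t : ℕ, ∑' s : Config n k,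
    lawAt G ch t s * (((∑ a : Fin p, ∑ b : Fin p, cost (hash p a b) G ch s : ℕ) : ℝ≥0∞) /
      (p : ℝ≥0∞) ^ 2) := by
  have hswap : ∀ f : Fin p → ℕ → ℝ≥0∞, ∑ a, ∑' t, f a t = ∑' t, ∑ a, f a t := fun f =>
    (Summable.tsum_finsetSum fun _ _ => ENNReal.summable).symm
  have hswap' : ∀ f : Fin p → Config n k → ℝ≥0∞, ∑ a, ∑' t, f a t = ∑' t, ∑ a, f a t := fun f =>
    (Summable.tsum_finsetSum fun _ _ => ENNReal.summable).symm
  simp only [expectedTime, expectedCost, hswap, hswap', ← Finset.mul_sum, div_eq_mul_inv,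
    ← ENNReal.tsum_mul_right, mul_assoc]
  push_cast
  rfl

lemma expectedTime_le_potential (hk : k = G.maxDegree + 1) (hp : p.Prime) (hn : n < p)
    (hl : (uncolored G χ).card ≠ 0) (ch : Choices G χ) :
    expectedTime p G ch ≤ potential ch ⟨χ, .pickEdge⟩ := by
  classical
  rw [expectedTime_eq]
  -- At states satisfying the invariant a successor exists, so the default branch of `step` is never
  -- taken.
  have hstep : ∀ s, Reachable G χ s → ∃ hs : next G ch s ≠ 0,
      step G ch s = PMF.ofMultiset (next G ch s) hs := fun s hs =>
    have h := (drift (ch := ch) hk hl hs).1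
    ⟨h, dif_pos h⟩
  refine tsum_cost_le_potential (κ := step G ch) (Inv := Reachable G χ) rfl (fun _ => rfl) rfl
    ?_ ?_
  · intro s hs s' hs'
    obtain ⟨h0, h⟩ := hstep s hs
    rw [h, PMF.mem_support_ofMultiset_iff, Multiset.mem_toFinset] at hs'
    exact reachable_next hs s' hs'
  · intro s hs
    obtain ⟨h0, h⟩ := hstep s hs
    have hp0 : (p : ℝ≥0∞) ^ 2 ≠ 0 := pow_ne_zero _ (by exact_mod_cast hp.ne_zero)
    rw [h, tsum_ofMultiset_mul]
    refine (add_le_add (ENNReal.div_le_of_le_mul (b := (costBound G s : ℝ≥0∞)) ?_) le_rfl).trans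
      (add_div_le_of_add_mul_le ?_ (ENNReal.natCast_ne_top _) (drift hk hl hs).2)
    · exact_mod_cast meanLE_cost (ch := ch) hk hp hn hs
    · exact_mod_cast (Multiset.card_pos.2 h0).ne'

lemma edgeWeight_eq_degree_low (ch : Choices G χ) (e : Sym2 (Fin n)) :
    edgeWeight G e = G.degree (ch.low e) := by
  conv_lhs => rw [← ch.ends_eq e]
  rw [edgeWeight_mk, min_eq_left (ch.degree_le e)]

lemma sum_degree_low_le (ch : Choices G χ) :
    ∑ e ∈ uncolored G χ, G.degree (ch.low e) ≤ graphWeight G := by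
  simp_rw [← edgeWeight_eq_degree_low ch]
  exact Finset.sum_le_sum_of_subset (Finset.filter_subset _ _)

/-- Every edge has weight at least one; this absorbs the additive constants into w(G)/l. -/
lemma card_uncolored_le (ch : Choices G χ) : (uncolored G χ).card ≤ graphWeight G := by
  refine le_trans ?_ (sum_degree_low_le ch)
  rw [Finset.card_eq_sum_ones]
  refine Finset.sum_le_sum fun e he => ?_
  have h := (Finset.mem_filter.1 he).1
  rw [SimpleGraph.mem_edgeFinset, ← ch.ends_eq e, SimpleGraph.mem_edgeSet] at h
  exact (G.degree_pos_iff_exists_adj _).2 ⟨_, h⟩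

lemma card_low_eq_le (hk : k = G.maxDegree + 1) (ch : Choices G χ) (u : Fin n) :
    ((uncolored G χ).filter fun e => ch.low e = u).card ≤ (missing G χ u).card := by
  refine le_trans (Finset.card_le_card_of_injOn ch.high ?_ ?_) (card_uncolored_at_le G hk χ u)
  · intro e he
    obtain ⟨heu, rfl⟩ := Finset.mem_filter.1 (Finset.mem_coe.1 he)
    obtain ⟨h, hc⟩ := Finset.mem_filter.1 heu
    rw [← ch.ends_eq e] at hc
    rw [SimpleGraph.mem_edgeFinset, ← ch.ends_eq e, SimpleGraph.mem_edgeSet] at h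
    simp [h, hc]
  · intro e he e' he' h
    rw [← ch.ends_eq e, ← ch.ends_eq e', (Finset.mem_filter.1 (Finset.mem_coe.1 he)).2,
      (Finset.mem_filter.1 (Finset.mem_coe.1 he')).2, h]

/-- Grouping the edges by their lower endpoint `u`, each group has at most |M(u)| members, which
cancels the denominator of `meanInner`. -/
lemma sum_meanInner_low_le (hk : k = G.maxDegree + 1) (hχ : IsPartialColoring G χ)
    (ch : Choices G χ) :
    ∑ e ∈ uncolored G χ, meanInner G χ (ch.low e) ≤ 2 * (graphWeight G : ℝ≥0∞) := by
  refine le_trans ?_ (sum_altInner_le hχ)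
  rw [← Finset.sum_fiberwise (uncolored G χ) ch.low]
  refine Finset.sum_le_sum fun u _ => ?_
  rw [← card_mul_meanInner hk, Finset.sum_congr rfl (g := fun _ => meanInner G χ u)
    (fun e he => by rw [(Finset.mem_filter.1 he).2]), Finset.sum_const, nsmul_eq_mul]
  gcongr
  exact card_low_eq_le hk ch u

lemma potential_pickEdge_le (hk : k = G.maxDegree + 1) (hχ : IsPartialColoring G χ)
    (hl : (uncolored G χ).card ≠ 0) (ch : Choices G χ) :
    potential ch ⟨χ, .pickEdge⟩ ≤
      213 * ((graphWeight G : ℝ≥0∞) / ((uncolored G χ).card : ℝ≥0∞)) := by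
  have hl0 : ((uncolored G χ).card : ℝ≥0∞) ≠ 0 := by exact_mod_cast hl
  have h1 : ((∑ e ∈ uncolored G χ, (42 * G.degree (ch.low e) + 124) : ℕ) : ℝ≥0∞) ≤
      166 * (graphWeight G : ℝ≥0∞) := by
    rw [Finset.sum_add_distrib, ← Finset.mul_sum, Finset.sum_const, smul_eq_mul]
    have := sum_degree_low_le ch
    have := card_uncolored_le ch
    norm_cast
    omega
  simp only [potential]
  rw [Finset.sum_add_distrib, ← Finset.mul_sum, ← Nat.cast_sum]
  -- 213 = 1 + 166 + 23 · 2, where 166 = 42 + 124.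
  calc _ ≤ (graphWeight G : ℝ≥0∞) / ((uncolored G χ).card : ℝ≥0∞) +
        (166 * (graphWeight G : ℝ≥0∞) + 23 * (2 * (graphWeight G : ℝ≥0∞))) /
          ((uncolored G χ).card : ℝ≥0∞) := by
        gcongr
        · rw [← ENNReal.div_self hl0 (ENNReal.natCast_ne_top _)]
          gcongr
          exact card_uncolored_le ch
        · exact sum_meanInner_low_le hk hχ ch
    _ = _ := by
        simp only [div_eq_mul_inv]
        ring

end

end EdgeColoring

theorem mainTheorem5 :
    ∃ C : ℕ, ∀ (n : ℕ) (G : SimpleGraph (Fin n)) [DecidableRel G.Adj]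
      (χ : EdgeColoring.Coloring n (G.maxDegree + 1)) (l p : ℕ)
      (ch : EdgeColoring.Choices G χ),
      EdgeColoring.IsPartialColoring G χ →
      (EdgeColoring.uncolored G χ).card = l → 0 < l →
      p.Prime → n < p →
      EdgeColoring.expectedTime p G ch
          ≤ (C : ENNReal) * ((EdgeColoring.graphWeight G : ENNReal) / (l : ENNReal)) ∧
        (EdgeColoring.graphWeight G : ENNReal) / (l : ENNReal)
          ≤ (C : ENNReal) *
            ((G.edgeFinset.card : ENNReal) * (EdgeColoring.arboricity G : ENNReal)
              / (l : ENNReal)) ∧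
        EdgeColoring.expectedTime p G ch
          ≤ (C : ENNReal) *
            ((G.edgeFinset.card : ENNReal) * (EdgeColoring.arboricity G : ENNReal)
              / (l : ENNReal)) := by
  -- 426 = 213 · 2, the product of the weight bound and the arboricity bound.
  refine ⟨426, fun n G _ χ l p ch hχ hl hl0 hp hn => ?_⟩
  subst hl
  have h1 := (EdgeColoring.expectedTime_le_potential rfl hp hn hl0.ne' ch).trans
    (EdgeColoring.potential_pickEdge_le rfl hχ hl0.ne' ch)
  have h2 : (EdgeColoring.graphWeight G : ENNReal) / ((EdgeColoring.uncolored G χ).card : ENNReal)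
      ≤ 2 * ((G.edgeFinset.card : ENNReal) * (EdgeColoring.arboricity G : ENNReal)
        / ((EdgeColoring.uncolored G χ).card : ENNReal)) := by
    rw [← mul_div_assoc]
    gcongr
    exact_mod_cast EdgeColoring.graphWeight_le G
  refine ⟨h1.trans ?_, h2.trans ?_, (h1.trans (mul_le_mul_right h2 _)).trans ?_⟩
  · gcongr
    norm_num
  · gcongr
    norm_num
  · rw [← mul_assoc]
    gcongr
    norm_num
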